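/- **Theorem 4.1.** Let $b>0$, $\alpha>-1$, and let $m\in\mathbb{C}$ satisfy $\operatorname{Re} m>-1$ and $\operatorname{Re} m+\alpha>-1$. Let $N\ge 1$ and $s\ge 0$ be integers and let $f\in C^{s+2}[0,b]$ (complex-valued). For $\omega\ge 1$ put $$I_1[g]=\int_0^b x^\alpha g(x)J_m(\omega x)\,dx,\qquad I_2[g]=\int_0^b x^\alpha \ln(x)\,g(x)J_m(\omega x)\,dx,$$ where $J_m$ is the Bessel function of the first kind of order $m$. Let $P=P_{N+2s}f$ be the unique polynomial of degree at most $N+2s$ such that, with the Clenshaw–Curtis points $c_n=\frac b2+\frac b2\cos\frac{n\pi}{N}$, $$P^{(k)}(0)=f^{(k)}(0),\qquad P(c_n)=f(c_n),\qquad P^{(k)}(b)=f^{(k)}(b)$$ for $k=0,\dots,s$ and $n=1,\dots,N-1$ (derivatives of $f$ at $0$ and $b$ being one-sided), and define the higher-order Clenshaw–Curtis–Filon (CCF) rules by $I_1^{HCCF}[f]=I_1[P]$ and $I_2^{HCCF}[f]=I_2[P]$. Let $$C_1(\omega)=\begin{cases}\omega^{-\alpha-1},&-1<\alpha<0,\\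 \omega^{-1},&\alpha\ge 0,\end{cases}\qquad C_2(\omega)=\begin{cases}(1+\ln\omega)\,\omega^{-\alpha-1},&-1<\alpha\le 0,\\ \omega^{-1},&\alpha>0.\end{cases}$$ Then the four integrals $I_1[f]$, $I_2[f]$, $I_1[P]$, $I_2[P]$ converge absolutely for every $\omega\ge1$, and $$\bigl|I_1[f]-I_1^{HCCF}[f]\bigr|=O\!\left(\frac{C_1(\omega)}{\omega^{s+1}}\right),\qquad \bigl|I_2[f]-I_2^{HCCF}[f]\bigr|=O\!\left(\frac{C_2(\omega)}{\omega^{s+1}}\right);$$ that is, there are constants $K_1,K_2$, independent of $\omega$, such that the left-hand sides are at most $K_1C_1(\omega)/\omega^{s+1}$ and $K_2C_2(\omega)/\omega^{s+1}$ for all $\omega\ge 1$. -/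

import Mathlib

open scoped Polynomial

noncomputable section

namespace HCCF

/-- The Bessel function of the first kind of complex order `ν`, principal branch:
`J_ν(z) = (z/2)^ν ∑_k (-1)^k / (k! Γ(k+ν+1)) (z/2)^(2k)`. -/
def besselJ (ν z : ℂ) : ℂ :=
  (z / 2) ^ ν * ∑' k : ℕ,
    (-1) ^ k / ((Nat.factorial k : ℂ) * Complex.Gamma (k + ν + 1)) * (z / 2) ^ (2 * k)

/-- The integrand `x^α f(x) J_m(ω x)`. -/
def integrand₁ (α : ℝ) (m : ℂ) (ω : ℝ) (f : ℝ → ℂ) (x : ℝ) : ℂ :=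
  ((x ^ α : ℝ) : ℂ) * f x * besselJ m ((ω * x : ℝ) : ℂ)

/-- The integrand `x^α ln(x) f(x) J_m(ω x)`. -/
def integrand₂ (α : ℝ) (m : ℂ) (ω : ℝ) (f : ℝ → ℂ) (x : ℝ) : ℂ :=
  ((x ^ α * Real.log x : ℝ) : ℂ) * f x * besselJ m ((ω * x : ℝ) : ℂ)

/-- `I₁[f] = ∫_0^b x^α f(x) J_m(ω x) dx`. -/
def I₁ (α b : ℝ) (m : ℂ) (ω : ℝ) (f : ℝ → ℂ) : ℂ :=
  ∫ x in (0 : ℝ)..b, integrand₁ α m ω f x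

/-- `I₂[f] = ∫_0^b x^α ln(x) f(x) J_m(ω x) dx`. -/
def I₂ (α b : ℝ) (m : ℂ) (ω : ℝ) (f : ℝ → ℂ) : ℂ :=
  ∫ x in (0 : ℝ)..b, integrand₂ α m ω f x

/-- The Clenshaw–Curtis points `b/2 + (b/2) cos(nπ/N)` on `[0, b]`. -/
def ccPoint (b : ℝ) (N n : ℕ) : ℝ :=
  b / 2 + b / 2 * Real.cos (n * Real.pi / N)

/-- `P` has degree at most `N + 2s`, agrees with `f` at the interior Clenshaw–Curtis points, and
its derivatives of order `0, …, s` agree with those of `f` at `0` and at `b` (the derivatives of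
`f` being those relative to `[0, b]`, hence one-sided at the endpoints). -/
structure IsHermiteInterpolant (b : ℝ) (N s : ℕ) (f : ℝ → ℂ) (P : ℂ[X]) : Prop where
  natDegree_le : P.natDegree ≤ N + 2 * s
  left : ∀ k ≤ s, (Polynomial.derivative^[k] P).eval 0 =
    iteratedDerivWithin k f (Set.Icc 0 b) 0
  node : ∀ n, 1 ≤ n → n ≤ N - 1 →
    P.eval ((ccPoint b N n : ℝ) : ℂ) = f (ccPoint b N n)
  right : ∀ k ≤ s, (Polynomial.derivative^[k] P).eval ((b : ℝ) : ℂ) =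
    iteratedDerivWithin k f (Set.Icc 0 b) b

/-- The polynomial `P_{N+2s} f`; see `existsUnique_isHermiteInterpolant`. -/
def hermiteInterpolant (b : ℝ) (N s : ℕ) (f : ℝ → ℂ) : ℂ[X] :=
  Classical.epsilon (IsHermiteInterpolant b N s f)

/-- The function `x ↦ P_{N+2s} f(x)` on the real line. -/
def hermiteFun (b : ℝ) (N s : ℕ) (f : ℝ → ℂ) (x : ℝ) : ℂ :=
  (hermiteInterpolant b N s f).eval (x : ℂ)

/-- The higher order Clenshaw–Curtis–Filon rule for `I₁`. -/
def I₁HCCF (α b : ℝ) (m : ℂ) (N s : ℕ) (ω : ℝ) (f : ℝ → ℂ) : ℂ :=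
  I₁ α b m ω (hermiteFun b N s f)

/-- The higher order Clenshaw–Curtis–Filon rule for `I₂`. -/
def I₂HCCF (α b : ℝ) (m : ℂ) (N s : ℕ) (ω : ℝ) (f : ℝ → ℂ) : ℂ :=
  I₂ α b m ω (hermiteFun b N s f)

/-- The rate `C₁(ω)`, up to a constant factor independent of `ω`. -/
def C₁ (α ω : ℝ) : ℝ :=
  if α < 0 then 1 / ω ^ (α + 1) else 1 / ω

/-- The rate `C₂(ω)`, up to a constant factor independent of `ω`. -/
def C₂ (α ω : ℝ) : ℝ :=
  if α ≤ 0 then (1 + Real.log ω) / ω ^ (α + 1) else 1 / ω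

/-! Existence and uniqueness of the interpolation polynomial. -/

theorem ccPoint_zero (b : ℝ) (N : ℕ) : ccPoint b N 0 = b := by
  simp [ccPoint]

theorem ccPoint_self (b : ℝ) {N : ℕ} (hN : 1 ≤ N) : ccPoint b N N = 0 := by
  have : (N : ℝ) ≠ 0 := by positivity
  simp [ccPoint, mul_div_cancel_left₀ Real.pi this]

theorem ccPoint_injective {b : ℝ} (hb : 0 < b) {N : ℕ} (hN : 1 ≤ N) :
    Function.Injective (fun n : Fin (N + 1) => ((ccPoint b N n : ℝ) : ℂ)) := by
  intro i j hij
  have hN' : (0 : ℝ) < N := by positivity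
  have h := Complex.ofReal_injective hij
  have h2 : Real.cos (i * Real.pi / N) = Real.cos (j * Real.pi / N) := by
    have : b / 2 * Real.cos (i * Real.pi / N) = b / 2 * Real.cos (j * Real.pi / N) := by
      simpa [ccPoint] using h
    exact mul_left_cancel₀ (by positivity) this
  have hmem : ∀ k : Fin (N + 1), (k * Real.pi / N : ℝ) ∈ Set.Icc 0 Real.pi := by
    intro k
    have hk : ((k : ℕ) : ℝ) ≤ N := by exact_mod_cast Nat.lt_succ_iff.mp k.2
    refine ⟨by positivity, ?_⟩
    rw [div_le_iff₀ hN', mul_comm]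
    exact mul_le_mul_of_nonneg_left hk Real.pi_pos.le
  have h3 := Real.injOn_cos (hmem i) (hmem j) h2
  have h4 : ((i : ℕ) : ℝ) = ((j : ℕ) : ℝ) := by
    have hpi := Real.pi_pos.ne'
    field_simp at h3
    exact h3
  exact Fin.ext (by exact_mod_cast h4)

/-- General Hermite interpolation: distinct nodes `c i` with multiplicities `μ i`. -/
theorem hermite_general {ι : Type} [Fintype ι] (c : ι → ℂ) (hc : Function.Injective c)
    (μ : ι → ℕ) (v : (i : ι) → Fin (μ i) → ℂ) :
    ∃! P : ℂ[X], P.degree < (∑ i, μ i : ℕ) ∧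
      ∀ i (k : Fin (μ i)), (Polynomial.derivative^[k] P).eval (c i) = v i k := by
  let L : Polynomial.degreeLT ℂ (∑ i, μ i) →ₗ[ℂ] ((i : ι) → Fin (μ i) → ℂ) :=
    LinearMap.pi fun i => LinearMap.pi fun k =>
      (Polynomial.leval (c i)).comp
        (((Polynomial.derivative : ℂ[X] →ₗ[ℂ] ℂ[X]) ^ (k : ℕ)).comp (Submodule.subtype _))
  have hL : ∀ p i k, L p i k = (Polynomial.derivative^[k] (p : ℂ[X])).eval (c i) := by
    intro p i k
    simp [L, Module.End.pow_apply, Polynomial.leval]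
  have hinj : Function.Injective L := by
    rw [injective_iff_map_eq_zero]
    intro p hp
    by_contra hne
    have hp0 : (p : ℂ[X]) ≠ 0 := fun h => hne (Subtype.ext h)
    have hdvd : ∀ i, (Polynomial.X - Polynomial.C (c i)) ^ μ i ∣ (p : ℂ[X]) := by
      intro i
      rw [← Polynomial.le_rootMultiplicity_iff hp0]
      rcases Nat.eq_zero_or_pos (μ i) with h | h
      · omega
      · have : μ i - 1 < (p : ℂ[X]).rootMultiplicity (c i) := by
          rw [Polynomial.lt_rootMultiplicity_iff_isRoot_iterate_derivative hp0]
          intro k hk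
          have := congrFun (congrFun hp i) ⟨k, by omega⟩
          rw [hL] at this
          simpa using this
        omega
    have hprod : (∏ i, (Polynomial.X - Polynomial.C (c i)) ^ μ i) ∣ (p : ℂ[X]) := by
      refine Finset.prod_dvd_of_coprime ?_ (fun i _ => hdvd i)
      intro i _ j _ hij
      exact (Polynomial.pairwise_coprime_X_sub_C hc hij).pow
    have hdeg := Polynomial.degree_le_of_dvd hprod hp0
    have hlt := Polynomial.mem_degreeLT.mp p.2
    rw [Polynomial.degree_prod] at hdeg
    simp only [Polynomial.degree_pow, Polynomial.degree_X_sub_C, nsmul_eq_mul, mul_one] at hdeg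
    have := lt_of_le_of_lt hdeg hlt
    push_cast at this
    exact lt_irrefl _ this
  have hfin : Module.finrank ℂ (Polynomial.degreeLT ℂ (∑ i, μ i)) =
      Module.finrank ℂ ((i : ι) → Fin (μ i) → ℂ) := by
    rw [(Polynomial.degreeLTEquiv ℂ (∑ i, μ i)).finrank_eq, Module.finrank_fin_fun,
      Module.finrank_pi_fintype]
    simp
  have : FiniteDimensional ℂ (Polynomial.degreeLT ℂ (∑ i, μ i)) :=
    (Polynomial.degreeLTEquiv ℂ (∑ i, μ i)).symm.finiteDimensional
  obtain ⟨p, hp⟩ := (LinearMap.injective_iff_surjective_of_finrank_eq_finrank hfin).mp hinj v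
  refine ⟨p, ⟨Polynomial.mem_degreeLT.mp p.2, fun i k => by rw [← hL, hp]⟩, ?_⟩
  rintro q ⟨hq, hq'⟩
  have : (⟨q, Polynomial.mem_degreeLT.mpr hq⟩ : Polynomial.degreeLT ℂ (∑ i, μ i)) = p := by
    apply hinj
    rw [hp]
    funext i k
    rw [hL]
    exact hq' i k
  exact congrArg Subtype.val this

theorem existsUnique_isHermiteInterpolant {b : ℝ} (hb : 0 < b) {N : ℕ} (hN : 1 ≤ N) (s : ℕ)
    (f : ℝ → ℂ) : ∃! P : ℂ[X], IsHermiteInterpolant b N s f P := by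
  let μ : Fin (N + 1) → ℕ := fun n => if (n : ℕ) = 0 ∨ (n : ℕ) = N then s + 1 else 1
  let v : (n : Fin (N + 1)) → Fin (μ n) → ℂ := fun n k =>
    iteratedDerivWithin k f (Set.Icc 0 b) (ccPoint b N n)
  have hsum : ∑ n, μ n = N + 2 * s + 1 := by
    obtain ⟨M, rfl⟩ : ∃ M, N = M + 1 := ⟨N - 1, by omega⟩
    rw [Fin.sum_univ_succ, Fin.sum_univ_castSucc]
    have h : ∀ i : Fin M, μ (Fin.castSucc i).succ = 1 := by
      intro i
      have := i.2
      simp only [μ]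
      rw [if_neg]
      simp
      omega
    simp only [h]
    simp [μ]
    omega
  have key : ∀ P : ℂ[X], IsHermiteInterpolant b N s f P ↔
      (P.degree < (∑ n, μ n : ℕ) ∧ ∀ n (k : Fin (μ n)),
        (Polynomial.derivative^[k] P).eval ((ccPoint b N n : ℝ) : ℂ) = v n k) := by
    intro P
    have hdeg : P.natDegree ≤ N + 2 * s ↔ P.degree < (∑ n, μ n : ℕ) := by
      rw [hsum, Polynomial.natDegree_le_iff_degree_le]
      rcases hd : P.degree with _ | d
      · exact iff_of_true bot_le (WithBot.bot_lt_coe _)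
      · change ((d : ℕ) : WithBot ℕ) ≤ ((N + 2 * s : ℕ) : WithBot ℕ) ↔
          ((d : ℕ) : WithBot ℕ) < ((N + 2 * s + 1 : ℕ) : WithBot ℕ)
        rw [Nat.cast_le, Nat.cast_lt]
        omega
    constructor
    · intro h
      refine ⟨hdeg.mp h.natDegree_le, ?_⟩
      intro n k
      have hk := k.2
      by_cases h0 : (n : ℕ) = 0
      · have hk' : (k : ℕ) ≤ s := by
          simp only [μ, h0, true_or, if_true] at hk; omega
        simpa [v, h0, ccPoint_zero] using h.right k hk'
      · by_cases h1 : (n : ℕ) = N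
        · have hk' : (k : ℕ) ≤ s := by
            simp only [μ, h1, or_true, if_true] at hk; omega
          simpa [v, h1, ccPoint_self b hN] using h.left k hk'
        · have hk' : (k : ℕ) = 0 := by
            simp only [μ, h0, h1, or_self, if_false] at hk; omega
          have hn := n.2
          simpa [v, hk'] using h.node n (by omega) (by omega)
    · rintro ⟨h1, h2⟩
      refine ⟨hdeg.mpr h1, ?_, ?_, ?_⟩
      · intro k hk
        simpa [v, ccPoint_self b hN] using
          h2 (Fin.last N) ⟨k, by simp [μ]; omega⟩
      · intro n hn hn'
        simpa [v] using h2 ⟨n, by omega⟩ ⟨0, by simp only [μ]; split_ifs <;> omega⟩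
      · intro k hk
        simpa [v, ccPoint_zero] using h2 0 ⟨k, by simp [μ]; omega⟩
  have := hermite_general _ (ccPoint_injective hb hN) μ v
  simpa only [key] using this

theorem isHermiteInterpolant_hermiteInterpolant {b : ℝ} (hb : 0 < b) {N : ℕ} (hN : 1 ≤ N) (s : ℕ)
    (f : ℝ → ℂ) : IsHermiteInterpolant b N s f (hermiteInterpolant b N s f) :=
  Classical.epsilon_spec (existsUnique_isHermiteInterpolant hb hN s f).exists

end HCCF

end

/-! The quadrature error is the same integral with amplitude g = f - P, and the Hermite conditions
make g vanish to order s+1 at both endpoints. Each order of vanishing buys a factor 1/ω. Indeed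
(x^{ν+1} J_{ν+1}(ωx))' = ω x^{ν+1} J_ν(ωx), so writing g = x·(g/x) and integrating by parts turns
ω∫x^α g J_ν into -∫x^α((α-ν-1)g/x + g')J_{ν+1}, with no boundary terms (`I₁_reduction`). The new
amplitude vanishes to one order less, α is unchanged, and ν has become ν+1, so the hypotheses on
real parts persist. With the logarithm, differentiating the weight adds one term of the first kind
with amplitude g/x (`I₂_reduction`). After s+1 steps a C¹ amplitude without vanishing conditions is
left, and it remains to show that its integrals are O(C₁) and O(C₂).

This base case is a van der Corput argument (`exists_norm_integral_mul_besselKernel_le`). For β ≤ 0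
the primitive of x^β J_ν(ωx) is O(ω^{-β-1}) uniformly in its endpoint, so the integral against H
costs only the endpoint values and total variation of H. For α ≤ 0 the factor x^α stays in the
kernel. For α > 0 the kernel has β = 0, and x^α or x^α ln x, which is of bounded variation, joins
the amplitude. If α ≤ 0 and a logarithm is present, the variation is infinite at 0. The integral is
then cut at 1/ω: the size of J_ν near 0 handles the left piece, and on the right ln x has variation
O(1 + ln ω).

No asymptotic expansion of J_ν is needed, only J_ν = O(x^{Re ν}) near 0 and boundedness on [1,∞). -/

namespace HCCF

open MeasureTheory Set Filter Topology

/-! ### The entire part of the Bessel function -/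

/-- The coefficients of the entire function `z ↦ (z/2)^(-ν) J_ν(z)` in powers of `(z/2)^2`. -/
noncomputable def besselCoeff (ν : ℂ) (k : ℕ) : ℂ :=
  (-1) ^ k / ((Nat.factorial k : ℂ) * Complex.Gamma (k + ν + 1))

/-- The entire function `φ_ν` with `J_ν(z) = (z/2)^ν φ_ν((z/2)^2)`. -/
noncomputable def besselEntire (ν w : ℂ) : ℂ := ∑' k : ℕ, besselCoeff ν k * w ^ k

theorem add_add_one_ne_zero {ν : ℂ} (hν : -1 < ν.re) (k : ℕ) : (k : ℂ) + ν + 1 ≠ 0 := by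
  intro h
  have h' := congrArg Complex.re h
  simp at h'
  have : (0 : ℝ) ≤ k := k.cast_nonneg
  linarith

theorem neg_one_lt_re_add_one {ν : ℂ} (hν : -1 < ν.re) : -1 < (ν + 1).re := by
  simp only [Complex.add_re, Complex.one_re]; linarith

theorem besselCoeff_shift {ν : ℂ} (hν : -1 < ν.re) (k : ℕ) :
    besselCoeff ν k = (k + ν + 1) * besselCoeff (ν + 1) k := by
  have h0 := add_add_one_ne_zero hν k
  have hG : Complex.Gamma (k + ν + 1) ≠ 0 := by
    apply Complex.Gamma_ne_zero_of_re_pos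
    simp
    have : (0 : ℝ) ≤ k := k.cast_nonneg
    linarith
  have := Complex.Gamma_add_one _ h0
  have hf : (Nat.factorial k : ℂ) ≠ 0 := by exact_mod_cast Nat.factorial_ne_zero k
  rw [besselCoeff, besselCoeff, ← add_assoc, this]
  field_simp

theorem besselCoeff_succ (ν : ℂ) (k : ℕ) :
    ((k : ℂ) + 1) * besselCoeff ν (k + 1) = - besselCoeff (ν + 1) k := by
  have hf : (Nat.factorial k : ℂ) ≠ 0 := by exact_mod_cast Nat.factorial_ne_zero k
  have hk : (k : ℂ) + 1 ≠ 0 := by exact_mod_cast Nat.succ_ne_zero k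
  have e : ((k + 1 : ℕ) : ℂ) + ν + 1 = k + (ν + 1) + 1 := by push_cast; ring
  rw [besselCoeff, besselCoeff, e, Nat.factorial_succ, pow_succ]
  push_cast
  field_simp

/-- Ratio test. The two coefficient relations, together with |k+ν+1| ≥ 1 for k ≥ 1, give
(k+1)|c_{k+1}| ≤ |c_k|, so no estimate of Gamma is needed. -/
theorem summable_besselCoeff {ν : ℂ} (hν : -1 < ν.re) (R : ℝ) :
    Summable fun k => ‖besselCoeff ν k‖ * R ^ k := by
  refine summable_of_ratio_norm_eventually_le (r := 1 / 2) (by norm_num) ?_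
  obtain ⟨K, hK⟩ := exists_nat_ge (2 * |R|)
  filter_upwards [eventually_ge_atTop (max K 1)] with k hk
  have hk1 : 1 ≤ k := le_trans (le_max_right _ _) hk
  have hkK : (K : ℝ) ≤ k := by exact_mod_cast le_trans (le_max_left _ _) hk
  have hk1' : (1 : ℝ) ≤ k := by exact_mod_cast hk1
  have h1 := besselCoeff_succ ν k
  have h2 := besselCoeff_shift hν k
  have hge : 1 ≤ ‖(k : ℂ) + ν + 1‖ := by
    refine le_trans ?_ (Complex.re_le_norm _)
    simp
    linarith
  have h3 : ((k : ℝ) + 1) * ‖besselCoeff ν (k + 1)‖ = ‖besselCoeff (ν + 1) k‖ := by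
    rw [← norm_neg (besselCoeff (ν + 1) k), ← h1, norm_mul]
    congr 1
    rw [show (k : ℂ) + 1 = ((k + 1 : ℕ) : ℂ) by push_cast; rfl, Complex.norm_natCast]
    push_cast; rfl
  have h4 : ‖besselCoeff (ν + 1) k‖ ≤ ‖besselCoeff ν k‖ := by
    rw [h2, norm_mul]
    exact le_mul_of_one_le_left (norm_nonneg _) hge
  simp only [norm_mul, norm_pow, Real.norm_eq_abs, abs_norm]
  rw [pow_succ]
  have h5 : |R| ≤ 1 / 2 * (k + 1) := by linarith
  calc ‖besselCoeff ν (k + 1)‖ * (|R| ^ k * |R|)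
      ≤ ‖besselCoeff ν (k + 1)‖ * (|R| ^ k * (1 / 2 * (k + 1))) := by gcongr
    _ = 1 / 2 * (((k : ℝ) + 1) * ‖besselCoeff ν (k + 1)‖ * |R| ^ k) := by ring
    _ ≤ 1 / 2 * (‖besselCoeff ν k‖ * |R| ^ k) := by rw [h3]; gcongr

theorem summable_besselEntire {ν : ℂ} (hν : -1 < ν.re) (w : ℂ) :
    Summable fun k => besselCoeff ν k * w ^ k :=
  .of_norm (by simpa using summable_besselCoeff hν ‖w‖)

/-- Termwise differentiation on a ball of radius ‖w‖ + 1. By `besselCoeff_succ` the differentiated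
series is, after an index shift, minus the series of order ν+1. -/
theorem hasDerivAt_besselEntire {ν : ℂ} (hν : -1 < ν.re) (w : ℂ) :
    HasDerivAt (besselEntire ν) (-besselEntire (ν + 1) w) w := by
  set R := ‖w‖ + 1 with hR
  have hu : Summable fun k : ℕ => ‖besselCoeff ν k * (k : ℂ)‖ * R ^ (k - 1) := by
    rw [← summable_nat_add_iff 1]
    refine (summable_besselCoeff (neg_one_lt_re_add_one hν) R).congr fun k => ?_
    rw [← norm_neg, ← besselCoeff_succ]
    simp [mul_comm]
  have := hasDerivAt_tsum_of_isPreconnected (g := fun k w => besselCoeff ν k * w ^ k)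
    (g' := fun k w => besselCoeff ν k * (k * w ^ (k - 1))) (t := Metric.ball 0 R) (y₀ := w) (y := w)
    hu Metric.isOpen_ball (convex_ball _ _).isPreconnected
    (fun k y _ => (hasDerivAt_pow k y).const_mul _)
    (fun k y hy => by
      have : ‖y‖ ≤ R := by simpa using (Metric.mem_ball.mp hy).le
      rw [← mul_assoc, norm_mul, norm_pow]
      gcongr) (by simp [hR]) (summable_besselEntire hν w) (by simp [hR])
  convert! this using 1
  have hs : Summable fun k => besselCoeff ν k * (k * w ^ (k - 1)) := by
    refine .of_norm_bounded hu fun k => ?_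
    rw [← mul_assoc, norm_mul, norm_pow]
    gcongr
    simp [hR]
  rw [hs.tsum_eq_zero_add, besselEntire, ← tsum_neg]
  simp only [Nat.cast_zero, zero_mul, mul_zero, zero_add, Nat.add_sub_cancel]
  refine tsum_congr fun k => ?_
  rw [← neg_mul, ← besselCoeff_succ]
  push_cast
  ring

/-- Split the factor k+ν+1 of `besselCoeff_shift` as (ν+1) + k; the part with k loses its first term
and shifts to order ν+2. -/
theorem besselEntire_recurrence {ν : ℂ} (hν : -1 < ν.re) (w : ℂ) :
    besselEntire ν w = (ν + 1) * besselEntire (ν + 1) w - w * besselEntire (ν + 1 + 1) w := by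
  have hν1 := neg_one_lt_re_add_one hν
  have s1 := (summable_besselEntire hν1 w)
  have s2 := (summable_besselEntire (neg_one_lt_re_add_one hν1) w)
  have e : ∀ k : ℕ, besselCoeff ν k * w ^ k = (ν + 1) * (besselCoeff (ν + 1) k * w ^ k) +
      (k : ℂ) * besselCoeff (ν + 1) k * w ^ k := fun k => by
    rw [besselCoeff_shift hν]; ring
  have e2 : ∀ k : ℕ, ((k + 1 : ℕ) : ℂ) * besselCoeff (ν + 1) (k + 1) * w ^ (k + 1) =
      - w * (besselCoeff (ν + 1 + 1) k * w ^ k) := fun k => by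
    push_cast
    rw [besselCoeff_succ]; ring
  have s3 : Summable fun k : ℕ => (k : ℂ) * besselCoeff (ν + 1) k * w ^ k := by
    rw [← summable_nat_add_iff 1]
    exact (s2.mul_left (-w)).congr fun k => (e2 k).symm
  rw [besselEntire, tsum_congr e, (s1.mul_left _).tsum_add s3, tsum_mul_left,
    s3.tsum_eq_zero_add, tsum_congr e2, tsum_mul_left]
  simp [besselEntire]
  ring

theorem continuous_besselEntire {ν : ℂ} (hν : -1 < ν.re) : Continuous (besselEntire ν) :=
  continuous_iff_continuousAt.2 fun w => (hasDerivAt_besselEntire hν w).continuousAt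

/-! ### Elementary properties of the Bessel function on the positive axis -/

theorem besselJ_eq (ν z : ℂ) : besselJ ν z = (z / 2) ^ ν * besselEntire ν ((z / 2) ^ 2) := by
  simp only [besselJ, besselEntire, besselCoeff, pow_mul]

theorem half_mem_slitPlane {x : ℝ} (hx : 0 < x) : (x : ℂ) / 2 ∈ Complex.slitPlane := by
  left
  simpa using hx

/-- `J_ν' = (ν/x) J_ν - J_{ν+1}`. -/
theorem hasDerivAt_besselJ {ν : ℂ} (hν : -1 < ν.re) {x : ℝ} (hx : 0 < x) :
    HasDerivAt (fun x : ℝ => besselJ ν x) (ν / x * besselJ ν x - besselJ (ν + 1) x) x := by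
  have hx0 : (x : ℂ) ≠ 0 := by exact_mod_cast hx.ne'
  have hx2 : (x : ℂ) / 2 ≠ 0 := by simpa using hx0
  have h1 : HasDerivAt (fun z : ℂ => z / 2) (1 / 2) (x : ℂ) := (hasDerivAt_id _).div_const 2
  have h2 := h1.cpow_const (c := ν) (half_mem_slitPlane hx)
  have h3 := (hasDerivAt_besselEntire hν (((x : ℂ) / 2) ^ 2)).comp (x : ℂ) (h1.pow 2)
  have h := (h2.mul h3).comp_ofReal
  simp only [besselJ_eq]
  convert! h using 1
  rw [Complex.cpow_sub _ _ hx2, Complex.cpow_add _ _ hx2]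
  simp
  field_simp
  ring

/-- `J_{ν+1}' = J_ν - ((ν+1)/x) J_{ν+1}`. -/
theorem hasDerivAt_besselJ_succ {ν : ℂ} (hν : -1 < ν.re) {x : ℝ} (hx : 0 < x) :
    HasDerivAt (fun x : ℝ => besselJ (ν + 1) x)
      (besselJ ν x - (ν + 1) / x * besselJ (ν + 1) x) x := by
  have hx0 : (x : ℂ) ≠ 0 := by exact_mod_cast hx.ne'
  have hx2 : (x : ℂ) / 2 ≠ 0 := by simpa using hx0
  convert! hasDerivAt_besselJ (neg_one_lt_re_add_one hν) hx using 1
  simp only [besselJ_eq]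
  rw [besselEntire_recurrence hν, Complex.cpow_add (ν + 1) _ hx2, Complex.cpow_add ν _ hx2,
    Complex.cpow_one]
  field_simp
  ring

theorem continuousOn_besselJ {ν : ℂ} (hν : -1 < ν.re) :
    ContinuousOn (fun x : ℝ => besselJ ν x) (Ioi 0) := fun _ hx =>
  (hasDerivAt_besselJ hν hx).continuousAt.continuousWithinAt

/-- `J_ν(x) = O(x^{Re ν})` on bounded intervals. -/
theorem exists_norm_besselJ_le_rpow {ν : ℂ} (hν : -1 < ν.re) (R : ℝ) :
    ∃ C, 0 ≤ C ∧ ∀ x : ℝ, 0 < x → x ≤ R → ‖besselJ ν x‖ ≤ C * x ^ ν.re := by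
  have hc : Continuous fun x : ℝ => besselEntire ν (((x : ℂ) / 2) ^ 2) :=
    (continuous_besselEntire hν).comp (by fun_prop)
  obtain ⟨C, hC⟩ := isCompact_Icc.exists_bound_of_continuousOn (s := Icc 0 R) hc.continuousOn
  refine ⟨(1 / 2) ^ ν.re * |C|, by positivity, fun x hx hxR => ?_⟩
  rw [besselJ_eq, norm_mul, show (x : ℂ) / 2 = ((x / 2 : ℝ) : ℂ) by push_cast; rfl,
    Complex.norm_cpow_eq_rpow_re_of_pos (by positivity), div_eq_mul_one_div x,
    Real.mul_rpow hx.le (by norm_num)]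
  have := hC x ⟨hx.le, hxR⟩
  rw [show (x : ℂ) / 2 = ((x * (1 / 2) : ℝ) : ℂ) by push_cast; ring] at this
  calc _ ≤ x ^ ν.re * (1 / 2) ^ ν.re * |C| := by
        gcongr
        exact this.trans (le_abs_self C)
    _ = _ := by ring

/-- `J_ν` is bounded on `[1, ∞)`: the energy `(|J_ν|² + |J_ν'|²) exp(|ν|²/x)` is nonincreasing. -/
theorem exists_norm_besselJ_le {ν : ℂ} (hν : -1 < ν.re) :
    ∃ C, 0 ≤ C ∧ ∀ x : ℝ, 1 ≤ x → ‖besselJ ν x‖ ≤ C := by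
  set a : ℝ → ℂ := fun x => besselJ ν x with ha
  set d : ℝ → ℂ := fun x => ν / x * besselJ ν x - besselJ (ν + 1) x with hd
  have had : ∀ x : ℝ, 0 < x → HasDerivAt a (d x) x := fun x hx => hasDerivAt_besselJ hν hx
  -- Bessel's equation, as a first-order system for J_ν and its derivative.
  have hdd : ∀ x : ℝ, 0 < x → HasDerivAt d (ν ^ 2 / x ^ 2 * a x - d x / x - a x) x := by
    intro x hx
    have hx0 : (x : ℂ) ≠ 0 := by exact_mod_cast hx.ne'
    have h1 : HasDerivAt (fun x : ℝ => ν / (x : ℂ)) (-ν / (x : ℂ) ^ 2) x := by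
      have := ((hasDerivAt_inv hx0).const_mul ν).comp_ofReal
      simpa [div_eq_mul_inv] using this
    have h := (h1.mul (had x hx)).sub (hasDerivAt_besselJ_succ hν hx)
    convert! h using 1
    simp only [ha, hd]
    field_simp
    ring
  set c : ℝ := ‖ν‖ ^ 2 with hc
  set E : ℝ → ℝ := fun x => (‖a x‖ ^ 2 + ‖d x‖ ^ 2) * Real.exp (c / x) with hE
  have hEd : ∀ x : ℝ, 0 < x → HasDerivAt E
      ((2 * inner ℝ (a x) (d x) + 2 * inner ℝ (d x) (ν ^ 2 / x ^ 2 * a x - d x / x - a x)) *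
        Real.exp (c / x) + (‖a x‖ ^ 2 + ‖d x‖ ^ 2) * (Real.exp (c / x) * (-c / x ^ 2))) x := by
    intro x hx
    have h1 := ((had x hx).norm_sq.add (hdd x hx).norm_sq)
    have h2 : HasDerivAt (fun x : ℝ => c / x) (-c / x ^ 2) x := by
      have := (hasDerivAt_inv hx.ne').const_mul c
      simpa [div_eq_mul_inv] using this
    exact h1.mul h2.exp
  have hEle : ∀ x : ℝ, 0 < x → deriv E x ≤ 0 := by
    intro x hx
    rw [(hEd x hx).deriv]
    have e1 : inner ℝ (d x) (ν ^ 2 / x ^ 2 * a x - d x / x - a x) =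
        inner ℝ (d x) (ν ^ 2 / x ^ 2 * a x) - ‖d x‖ ^ 2 / x - inner ℝ (a x) (d x) := by
      rw [inner_sub_right, inner_sub_right, real_inner_comm (d x) (a x)]
      congr 2
      rw [show d x / (x : ℂ) = (1 / x : ℝ) • d x by
        rw [Complex.real_smul]; push_cast; ring, inner_smul_right, real_inner_self_eq_norm_sq]
      ring
    have e2 : inner ℝ (d x) (ν ^ 2 / x ^ 2 * a x) ≤ c / x ^ 2 * (‖d x‖ * ‖a x‖) := by
      refine (real_inner_le_norm _ _).trans ?_
      rw [norm_mul, norm_div, norm_pow, norm_pow, Complex.norm_real, Real.norm_of_nonneg hx.le]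
      exact le_of_eq (by ring)
    have e3 : 0 ≤ c / x ^ 2 := by positivity
    have e4 : 0 ≤ ‖d x‖ ^ 2 / x := by positivity
    -- The inner products of a and d cancel and the damping term has the right sign. The only
    -- harmful term is the one with ν²/x², and the derivative of exp(c/x) absorbs it by the
    -- inequality 2uv ≤ u² + v².
    have e5 : 2 * (c / x ^ 2 * (‖d x‖ * ‖a x‖)) ≤ c / x ^ 2 * (‖a x‖ ^ 2 + ‖d x‖ ^ 2) := by
      nlinarith [mul_nonneg e3 (sq_nonneg (‖d x‖ - ‖a x‖))]
    rw [e1]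
    have : (2 * inner ℝ (a x) (d x) + 2 * (inner ℝ (d x) (ν ^ 2 / x ^ 2 * a x) - ‖d x‖ ^ 2 / x -
        inner ℝ (a x) (d x))) * Real.exp (c / x) + (‖a x‖ ^ 2 + ‖d x‖ ^ 2) *
        (Real.exp (c / x) * (-c / x ^ 2)) = (2 * inner ℝ (d x) (ν ^ 2 / x ^ 2 * a x) -
        2 * (‖d x‖ ^ 2 / x) - c / x ^ 2 * (‖a x‖ ^ 2 + ‖d x‖ ^ 2)) * Real.exp (c / x) := by ring
    rw [this]
    exact mul_nonpos_of_nonpos_of_nonneg (by linarith) (Real.exp_pos _).le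
  have hanti : AntitoneOn E (Ici 1) := by
    refine antitoneOn_of_deriv_nonpos (convex_Ici 1) ?_ ?_ ?_
    · exact fun x hx => (hEd x (zero_lt_one.trans_le hx)).continuousAt.continuousWithinAt
    · intro x hx
      rw [interior_Ici] at hx
      exact (hEd x (zero_lt_one.trans hx)).differentiableAt.differentiableWithinAt
    · intro x hx
      rw [interior_Ici] at hx
      exact hEle x (zero_lt_one.trans hx)
  refine ⟨Real.sqrt (E 1), Real.sqrt_nonneg _, fun x hx => ?_⟩
  refine Real.le_sqrt_of_sq_le ?_
  refine le_trans ?_ (hanti (mem_Ici.2 le_rfl) hx hx)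
  have h1 : 1 ≤ Real.exp (c / x) := Real.one_le_exp (by positivity)
  calc ‖besselJ ν x‖ ^ 2 ≤ ‖a x‖ ^ 2 + ‖d x‖ ^ 2 := le_add_of_nonneg_right (by positivity)
    _ ≤ E x := le_mul_of_one_le_right (by positivity) h1

/-! ### Integrability of the weighted integrands -/

theorem abs_log_le {ε x : ℝ} (hε : 0 < ε) (hx : 0 < x) :
    |Real.log x| ≤ x ^ ε / ε + x ^ (-ε) / ε := by
  have h1 := Real.log_le_rpow_div hx.le hε
  have h2 := Real.log_le_rpow_div (inv_pos.2 hx).le hε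
  rw [Real.log_inv, Real.inv_rpow hx.le, ← Real.rpow_neg hx.le] at h2
  have h3 : 0 ≤ x ^ ε / ε := by positivity
  have h4 : 0 ≤ x ^ (-ε) / ε := by positivity
  exact abs_le.2 ⟨by linarith, by linarith⟩

theorem intervalIntegrable_of_continuousOn_of_norm_le {E : Type*} [NormedAddCommGroup E]
    {f : ℝ → E} {g : ℝ → ℝ} {b : ℝ} (hb : 0 ≤ b) (hf : ContinuousOn f (Ioc 0 b))
    (hg : IntervalIntegrable g volume 0 b) (hfg : ∀ x, 0 < x → x ≤ b → ‖f x‖ ≤ g x) :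
    IntervalIntegrable f volume 0 b := by
  refine hg.mono_fun' ?_ ?_
  · rw [uIoc_of_le hb]
    exact hf.aestronglyMeasurable measurableSet_Ioc
  · rw [uIoc_of_le hb]
    exact (ae_restrict_iff' measurableSet_Ioc).2 (.of_forall fun x hx => hfg x hx.1 hx.2)

theorem continuousOn_rpow_Ioi (r : ℝ) : ContinuousOn (fun x : ℝ => x ^ r) (Ioi 0) := fun x hx =>
  (Real.continuousAt_rpow_const x r (.inl (ne_of_gt hx))).continuousWithinAt

theorem continuousOn_log_Ioi : ContinuousOn Real.log (Ioi 0) :=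
  Real.continuousOn_log.mono fun _ hx => ne_of_gt hx

theorem intervalIntegrable_rpow_mul_abs_log {r b : ℝ} (hr : -1 < r) (hb : 0 ≤ b) :
    IntervalIntegrable (fun x => x ^ r * |Real.log x|) volume 0 b := by
  obtain ⟨ε, hε, hεr⟩ : ∃ ε, 0 < ε ∧ -1 < r - ε := ⟨(r + 1) / 2, by linarith, by linarith⟩
  refine intervalIntegrable_of_continuousOn_of_norm_le hb
    (g := fun x => x ^ (r + ε) / ε + x ^ (r - ε) / ε) ?_ ?_ ?_
  · exact ((continuousOn_rpow_Ioi r).mul continuousOn_log_Ioi.abs).mono fun x hx => hx.1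
  · exact ((intervalIntegral.intervalIntegrable_rpow' (by linarith)).div_const ε).add
      ((intervalIntegral.intervalIntegrable_rpow' hεr).div_const ε)
  · intro x hx _
    have : 0 ≤ x ^ r := by positivity
    rw [Real.norm_eq_abs, abs_mul, abs_abs, abs_of_nonneg this, sub_eq_add_neg,
      Real.rpow_add hx, Real.rpow_add hx]
    calc _ ≤ x ^ r * (x ^ ε / ε + x ^ (-ε) / ε) := by
          gcongr
          exact abs_log_le hε hx
      _ = _ := by ring

theorem continuousOn_besselJ_mul {ν : ℂ} (hν : -1 < ν.re) {ω : ℝ} (hω : 0 < ω) :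
    ContinuousOn (fun x : ℝ => besselJ ν ((ω * x : ℝ) : ℂ)) (Ioi 0) :=
  (continuousOn_besselJ hν).comp (by fun_prop) fun _ hx => mul_pos hω hx

theorem intervalIntegrable_mul_besselJ {ν : ℂ} (hν : -1 < ν.re) {b : ℝ} (hb : 0 ≤ b)
    {w : ℝ → ℂ} (hw : ContinuousOn w (Ioc 0 b))
    (hwi : IntervalIntegrable (fun x => ‖w x‖ * x ^ ν.re) volume 0 b) {ω : ℝ} (hω : 0 < ω) :
    IntervalIntegrable (fun x => w x * besselJ ν ((ω * x : ℝ) : ℂ)) volume 0 b := by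
  obtain ⟨C, hC0, hC⟩ := exists_norm_besselJ_le_rpow hν (ω * b)
  refine intervalIntegrable_of_continuousOn_of_norm_le hb
    (g := fun x => C * ω ^ ν.re * (‖w x‖ * x ^ ν.re)) ?_ (hwi.const_mul _) fun x hx hxb => ?_
  · exact hw.mul ((continuousOn_besselJ_mul hν hω).mono fun x hx => hx.1)
  · rw [norm_mul]
    calc ‖w x‖ * ‖besselJ ν ((ω * x : ℝ) : ℂ)‖ ≤ ‖w x‖ * (C * (ω * x) ^ ν.re) := by
          gcongr
          exact hC _ (mul_pos hω hx) (by gcongr)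
      _ = _ := by rw [Real.mul_rpow hω.le hx.le]; ring

theorem intervalIntegrable_weight_mul_besselJ {ν : ℂ} (hν : -1 < ν.re) {b : ℝ} (hb : 0 ≤ b)
    {w : ℝ → ℝ} (hw : ContinuousOn w (Ioi 0))
    (hwi : IntervalIntegrable (fun x => |w x| * x ^ ν.re) volume 0 b)
    {h : ℝ → ℂ} (hh : ContinuousOn h (Icc 0 b)) {ω : ℝ} (hω : 0 < ω) :
    IntervalIntegrable (fun x => (w x : ℂ) * h x * besselJ ν ((ω * x : ℝ) : ℂ)) volume 0 b := by
  have hw' : ContinuousOn (fun x => (w x : ℂ)) (Ioc 0 b) :=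
    Complex.continuous_ofReal.comp_continuousOn (hw.mono fun x hx => hx.1)
  have hc : ContinuousOn (fun x => (w x : ℂ) * h x) (Ioc 0 b) := hw'.mul (hh.mono Ioc_subset_Icc_self)
  obtain ⟨B, hB⟩ := isCompact_Icc.exists_bound_of_continuousOn hh
  refine intervalIntegrable_mul_besselJ hν hb hc ?_ hω
  refine intervalIntegrable_of_continuousOn_of_norm_le hb
    (g := fun x => B * (|w x| * x ^ ν.re)) ?_ (hwi.const_mul _) fun x hx hxb => ?_
  · exact hc.norm.mul ((continuousOn_rpow_Ioi _).mono fun x hx => hx.1)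
  · have hB' := hB x ⟨hx.le, hxb⟩
    rw [norm_mul, norm_norm, norm_mul, Complex.norm_real, Real.norm_eq_abs,
      Real.norm_of_nonneg (by positivity)]
    calc |w x| * ‖h x‖ * x ^ ν.re ≤ |w x| * B * x ^ ν.re := by gcongr
      _ = _ := by ring

theorem intervalIntegrable_integrand₁ {α b : ℝ} {ν : ℂ} (hν : -1 < ν.re) (hα : -1 < α + ν.re)
    (hb : 0 ≤ b) {h : ℝ → ℂ} (hh : ContinuousOn h (Icc 0 b)) {ω : ℝ} (hω : 0 < ω) :
    IntervalIntegrable (integrand₁ α ν ω h) volume 0 b := by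
  refine intervalIntegrable_weight_mul_besselJ hν hb (continuousOn_rpow_Ioi α) ?_ hh hω
  refine intervalIntegrable_of_continuousOn_of_norm_le hb (g := fun x => x ^ (α + ν.re)) ?_
    (intervalIntegral.intervalIntegrable_rpow' hα) fun x hx hxb => ?_
  · exact ((continuousOn_rpow_Ioi _).abs.mul (continuousOn_rpow_Ioi _)).mono fun x hx => hx.1
  · rw [abs_of_nonneg (by positivity), Real.norm_of_nonneg (by positivity), Real.rpow_add hx]

theorem intervalIntegrable_integrand₂ {α b : ℝ} {ν : ℂ} (hν : -1 < ν.re) (hα : -1 < α + ν.re)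
    (hb : 0 ≤ b) {h : ℝ → ℂ} (hh : ContinuousOn h (Icc 0 b)) {ω : ℝ} (hω : 0 < ω) :
    IntervalIntegrable (integrand₂ α ν ω h) volume 0 b := by
  have hc : ContinuousOn (fun x : ℝ => x ^ α * Real.log x) (Ioi 0) :=
    (continuousOn_rpow_Ioi α).mul continuousOn_log_Ioi
  refine intervalIntegrable_weight_mul_besselJ hν hb hc ?_ hh hω
  refine intervalIntegrable_of_continuousOn_of_norm_le hb
    (g := fun x => x ^ (α + ν.re) * |Real.log x|) ?_
    (intervalIntegrable_rpow_mul_abs_log hα hb) fun x hx hxb => ?_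
  · exact (hc.abs.mul (continuousOn_rpow_Ioi _)).mono fun x hx => hx.1
  · rw [abs_mul, abs_of_nonneg (by positivity : 0 ≤ x ^ α), Real.norm_of_nonneg (by positivity),
      Real.rpow_add hx]
    exact le_of_eq (by ring)

/-! ### The primitive of `x^β J_ν(ωx)` -/

/-- The integrand `x^β J_ν(ωx)`. -/
noncomputable def besselKernel (β : ℝ) (ν : ℂ) (ω x : ℝ) : ℂ :=
  ((x ^ β : ℝ) : ℂ) * besselJ ν ((ω * x : ℝ) : ℂ)

theorem intervalIntegrable_besselKernel {β b : ℝ} {ν : ℂ} (hν : -1 < ν.re) (hβ : -1 < β + ν.re)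
    (hb : 0 ≤ b) {ω : ℝ} (hω : 0 < ω) :
    IntervalIntegrable (besselKernel β ν ω) volume 0 b := by
  have h := intervalIntegrable_integrand₁ hν hβ hb (h := fun _ => 1) continuousOn_const hω
  refine h.congr fun x _ => ?_
  simp [integrand₁, besselKernel]

/-- The classical identity has γ = ν+1. A general real exponent leaves a remainder whose power of x
is lower by one, which is the gain in each integration by parts below. -/
theorem hasDerivAt_rpow_mul_besselJ {γ : ℝ} {ν : ℂ} (hν : -1 < ν.re) {x : ℝ} (hx : 0 < x) :
    HasDerivAt (fun x : ℝ => ((x ^ γ : ℝ) : ℂ) * besselJ (ν + 1) x)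
      (((x ^ γ : ℝ) : ℂ) * besselJ ν x +
        (γ - ν - 1) * (((x ^ (γ - 1) : ℝ) : ℂ) * besselJ (ν + 1) x)) x := by
  have h1 := (Real.hasDerivAt_rpow_const (p := γ) (.inl hx.ne')).ofReal_comp
  have h := h1.mul (hasDerivAt_besselJ_succ hν hx)
  convert! h using 1
  have hx0 : (x : ℂ) ≠ 0 := by exact_mod_cast hx.ne'
  rw [Real.rpow_sub_one hx.ne']
  push_cast
  field_simp
  ring

/-- Two integrations by parts lower the power to β-2 ≤ -2, which is integrable at infinity against a
merely bounded Bessel function. One would not suffice: at β = 0 it leaves the power -1. -/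
theorem exists_norm_integral_rpow_mul_besselJ_le {β : ℝ} {ν : ℂ} (hν : -1 < ν.re) (hβ : β ≤ 0) :
    ∃ M, ∀ T : ℝ, 1 ≤ T → ‖∫ u in (1 : ℝ)..T, ((u ^ β : ℝ) : ℂ) * besselJ ν u‖ ≤ M := by
  have hν1 := neg_one_lt_re_add_one hν
  have hν2 := neg_one_lt_re_add_one hν1
  obtain ⟨A, hA0, hA⟩ := exists_norm_besselJ_le hν1
  obtain ⟨B, hB0, hB⟩ := exists_norm_besselJ_le hν2
  set c₁ : ℂ := β - ν - 1
  set c₂ : ℂ := (β - 1 : ℝ) - (ν + 1) - 1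
  -- Q is chosen so that the remainder with x^{β-1} J_{ν+1} cancels in its derivative.
  set Q : ℝ → ℂ := fun x => ((x ^ β : ℝ) : ℂ) * besselJ (ν + 1) x -
    c₁ * (((x ^ (β - 1) : ℝ) : ℂ) * besselJ (ν + 1 + 1) x)
  set r : ℝ → ℂ := fun x => ((x ^ (β - 1 - 1) : ℝ) : ℂ) * besselJ (ν + 1 + 1) x
  have hQ : ∀ x : ℝ, 0 < x → HasDerivAt Q
      (((x ^ β : ℝ) : ℂ) * besselJ ν x - c₁ * c₂ * r x) x := by
    intro x hx
    have h := (hasDerivAt_rpow_mul_besselJ (γ := β) hν hx).sub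
      ((hasDerivAt_rpow_mul_besselJ (γ := β - 1) hν1 hx).const_mul c₁)
    convert! h using 1
    simp only [r, c₁, c₂]
    ring
  have hle : ∀ γ : ℝ, γ ≤ 0 → ∀ x : ℝ, 1 ≤ x → x ^ γ ≤ 1 := fun γ hγ x hx =>
    Real.rpow_le_one_of_one_le_of_nonpos hx hγ
  have hQb : ∀ x : ℝ, 1 ≤ x → ‖Q x‖ ≤ A + ‖c₁‖ * B := by
    intro x hx
    have hx0 : 0 < x := zero_lt_one.trans_le hx
    refine (norm_sub_le _ _).trans ?_
    rw [norm_mul, norm_mul, norm_mul, Complex.norm_real, Complex.norm_real,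
      Real.norm_of_nonneg (by positivity), Real.norm_of_nonneg (by positivity)]
    calc _ ≤ 1 * A + ‖c₁‖ * (1 * B) := by
          gcongr
          exacts [hle _ hβ x hx, hA x hx, hle _ (by linarith) x hx, hB x hx]
      _ = _ := by ring
  refine ⟨(A + ‖c₁‖ * B) + (A + ‖c₁‖ * B) + ‖c₁‖ * ‖c₂‖ * B, fun T hT => ?_⟩
  have hsub : uIcc 1 T ⊆ Ioi 0 := by
    rw [uIcc_of_le hT]
    exact fun x hx => zero_lt_one.trans_le hx.1
  have hci : ∀ (γ : ℝ) {μ : ℂ}, -1 < μ.re →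
      IntervalIntegrable (fun x : ℝ => ((x ^ γ : ℝ) : ℂ) * besselJ μ x) volume 1 T := by
    intro γ μ hμ
    refine ContinuousOn.intervalIntegrable ?_
    exact ((Complex.continuous_ofReal.comp_continuousOn (continuousOn_rpow_Ioi γ)).mul
      (continuousOn_besselJ hμ)).mono hsub
  have hri : IntervalIntegrable r volume 1 T := hci _ hν2
  have h1 := intervalIntegral.integral_eq_sub_of_hasDerivAt (fun x hx => hQ x (hsub hx))
    ((hci β hν).sub (hri.const_mul (c₁ * c₂)))
  rw [intervalIntegral.integral_sub (hci β hν) (hri.const_mul (c₁ * c₂)),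
    intervalIntegral.integral_const_mul, sub_eq_iff_eq_add] at h1
  rw [h1]
  have hrb : ‖∫ x in (1 : ℝ)..T, r x‖ ≤ B := by
    have hi : IntervalIntegrable (fun x : ℝ => B * x ^ (-2 : ℝ)) volume 1 T :=
      (ContinuousOn.intervalIntegrable
        ((continuousOn_rpow_Ioi (-2)).mono hsub)).const_mul B
    refine (intervalIntegral.norm_integral_le_of_norm_le hT (g := fun x => B * x ^ (-2 : ℝ))
      (.of_forall fun x hx => ?_) hi).trans ?_
    · have hx0 : 0 < x := zero_lt_one.trans hx.1
      simp only [r]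
      rw [norm_mul, Complex.norm_real, Real.norm_of_nonneg (by positivity), mul_comm]
      gcongr
      exacts [hB x hx.1.le, hx.1.le, by linarith]
    · rw [intervalIntegral.integral_const_mul, integral_rpow (.inr ⟨by norm_num, fun h => ?_⟩)]
      · norm_num
        have : 0 ≤ T ^ (-1 : ℝ) := by positivity
        nlinarith
      · exact lt_irrefl (0 : ℝ) (hsub h)
  refine (norm_add_le _ _).trans (add_le_add ((norm_sub_le _ _).trans
    (add_le_add (hQb T hT) (hQb 1 le_rfl))) ?_)
  rw [norm_mul, norm_mul]
  gcongr

/-- `∫_0^y x^β J_ν(ωx) dx = O(ω^{-β-1})` uniformly in `y`, for `β ≤ 0`. -/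
theorem exists_norm_integral_besselKernel_le {β : ℝ} {ν : ℂ} (hν : -1 < ν.re) (hβ : β ≤ 0)
    (hβν : -1 < β + ν.re) :
    ∃ M, 0 ≤ M ∧ ∀ ω : ℝ, 0 < ω → ∀ y : ℝ, 0 ≤ y →
      ‖∫ x in (0 : ℝ)..y, besselKernel β ν ω x‖ ≤ M * ω ^ (-β - 1) := by
  obtain ⟨M, hM⟩ := exists_norm_integral_rpow_mul_besselJ_le hν hβ
  set k : ℝ → ℂ := fun u => ((u ^ β : ℝ) : ℂ) * besselJ ν u with hk
  have hki : ∀ T : ℝ, 0 ≤ T → IntervalIntegrable k volume 0 T := by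
    intro T hT
    refine (intervalIntegrable_besselKernel hν hβν hT one_pos).congr fun x _ => ?_
    simp [besselKernel, hk]
  have hM0 : 0 ≤ M := (norm_nonneg _).trans (hM 1 le_rfl)
  set M₀ := ∫ u in (0 : ℝ)..1, ‖k u‖
  have hM₀ : 0 ≤ M₀ := intervalIntegral.integral_nonneg zero_le_one fun _ _ => norm_nonneg _
  have hsmall : ∀ T : ℝ, 0 ≤ T → T ≤ 1 → ‖∫ u in (0 : ℝ)..T, k u‖ ≤ M₀ := by
    intro T hT hT1
    refine (intervalIntegral.norm_integral_le_integral_norm hT).trans ?_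
    exact intervalIntegral.integral_mono_interval le_rfl hT hT1
      (.of_forall fun _ => norm_nonneg _) (hki 1 zero_le_one).norm
  have hall : ∀ T : ℝ, 0 ≤ T → ‖∫ u in (0 : ℝ)..T, k u‖ ≤ M₀ + M := by
    intro T hT
    rcases le_total T 1 with h | h
    · exact (hsmall T hT h).trans (le_add_of_nonneg_right hM0)
    · have h01 := hki 1 zero_le_one
      rw [← intervalIntegral.integral_add_adjacent_intervals h01 (h01.symm.trans (hki T hT))]
      exact (norm_add_le _ _).trans (add_le_add (hsmall 1 zero_le_one le_rfl) (hM T h))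
  refine ⟨M₀ + M, by positivity, fun ω hω y hy => ?_⟩
  -- Substituting u = ωx extracts the power of ω; uniformity in y then becomes a bound for all T =
  -- ωy.
  have e : ∫ x in (0 : ℝ)..y, besselKernel β ν ω x =
      ((ω ^ (-β - 1) : ℝ) : ℂ) * ∫ u in (0 : ℝ)..(ω * y), k u := by
    have h1 := intervalIntegral.integral_comp_mul_left (a := 0) (b := y) k hω.ne'
    rw [mul_zero] at h1
    have h2 : ∫ x in (0 : ℝ)..y, besselKernel β ν ω x =
        ((ω ^ (-β) : ℝ) : ℂ) * ∫ x in (0 : ℝ)..y, k (ω * x) := by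
      rw [← intervalIntegral.integral_const_mul]
      refine intervalIntegral.integral_congr fun x hx => ?_
      rw [uIcc_of_le hy] at hx
      simp only [besselKernel, hk]
      rw [Real.mul_rpow hω.le hx.1, ← mul_assoc, ← Complex.ofReal_mul, ← mul_assoc,
        ← Real.rpow_add hω]
      simp
    rw [h2, h1, Real.rpow_sub_one hω.ne', Complex.real_smul, ← mul_assoc, ← Complex.ofReal_mul,
      div_eq_mul_inv]
  rw [e, norm_mul, Complex.norm_real, Real.norm_of_nonneg (by positivity), mul_comm]
  gcongr
  exact hall _ (by positivity)

theorem hasDerivAt_integral_of_continuousOn_Ioi {k : ℝ → ℂ} (hk : ContinuousOn k (Ioi 0)) {x : ℝ}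
    (hx : 0 < x) (hi : IntervalIntegrable k volume 0 x) :
    HasDerivAt (fun y => ∫ t in (0 : ℝ)..y, k t) (k x) x :=
  intervalIntegral.integral_hasDerivAt_right hi
    (hk.stronglyMeasurableAtFilter isOpen_Ioi x hx) (hk.continuousAt (Ioi_mem_nhds hx))

/-- The integral of `H` against `x^β J_ν(ωx)` is controlled by the supremum and the total variation
of `H`, uniformly in the interval. -/
theorem exists_norm_integral_mul_besselKernel_le {β : ℝ} {ν : ℂ} (hν : -1 < ν.re) (hβ : β ≤ 0)
    (hβν : -1 < β + ν.re) :
    ∃ M, 0 ≤ M ∧ ∀ ω : ℝ, 0 < ω → ∀ a b : ℝ, 0 ≤ a → a ≤ b → ∀ H H' : ℝ → ℂ,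
      ContinuousOn H (Icc a b) → (∀ x ∈ Ioo a b, HasDerivAt H (H' x) x) →
      IntervalIntegrable H' volume a b →
      ‖∫ x in a..b, H x * besselKernel β ν ω x‖ ≤
        M * ω ^ (-β - 1) * (‖H b‖ + ‖H a‖ + ∫ x in a..b, ‖H' x‖) := by
  obtain ⟨M, hM0, hM⟩ := exists_norm_integral_besselKernel_le hν hβ hβν
  refine ⟨M, hM0, fun ω hω a b ha hab H H' hH hH' hi => ?_⟩
  set F : ℝ → ℂ := fun y => ∫ x in (0 : ℝ)..y, besselKernel β ν ω x
  set D := M * ω ^ (-β - 1)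
  have hF : ∀ y, 0 ≤ y → ‖F y‖ ≤ D := fun y hy => hM ω hω y hy
  have hk0 := fun (y : ℝ) (hy : 0 ≤ y) => intervalIntegrable_besselKernel hν hβν hy hω
  have hki : IntervalIntegrable (besselKernel β ν ω) volume a b :=
    (hk0 a ha).symm.trans (hk0 b (ha.trans hab))
  have hkc : ContinuousOn (besselKernel β ν ω) (Ioi 0) :=
    (Complex.continuous_ofReal.comp_continuousOn (continuousOn_rpow_Ioi β)).mul
      (continuousOn_besselJ_mul hν hω)
  have hFc : ContinuousOn F (Icc a b) := by
    have hI : IntegrableOn (besselKernel β ν ω) (uIcc 0 b) volume := by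
      rw [uIcc_of_le (ha.trans hab)]
      exact (intervalIntegrable_iff_integrableOn_Icc_of_le (ha.trans hab)).1 (hk0 b (ha.trans hab))
    have := intervalIntegral.continuousOn_primitive_interval hI
    rw [uIcc_of_le (ha.trans hab)] at this
    exact this.mono (Icc_subset_Icc_left ha)
  have hFd : ∀ x ∈ Ioo a b, HasDerivAt F (besselKernel β ν ω x) x := by
    intro x hx
    have hx0 : 0 < x := ha.trans_lt hx.1
    exact hasDerivAt_integral_of_continuousOn_Ioi hkc hx0 (hk0 x hx0.le)
  -- The kernel is integrated and H differentiated; the primitive F is at most D throughout.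
  have h := intervalIntegral.integral_mul_deriv_eq_deriv_mul_of_hasDerivAt (u := H) (v := F)
    (u' := H') (v' := besselKernel β ν ω) (a := a) (b := b)
    (by rwa [uIcc_of_le hab]) (by rwa [uIcc_of_le hab])
    (by rwa [min_eq_left hab, max_eq_right hab]) (by rwa [min_eq_left hab, max_eq_right hab]) hi hki
  rw [h]
  have hD : 0 ≤ D := by positivity
  have h3 : ‖∫ x in a..b, H' x * F x‖ ≤ (∫ x in a..b, ‖H' x‖) * D := by
    rw [← intervalIntegral.integral_mul_const]
    refine intervalIntegral.norm_integral_le_of_norm_le hab (.of_forall fun x hx => ?_)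
      (hi.norm.mul_const D)
    rw [norm_mul]
    gcongr
    exact hF x (ha.trans hx.1.le)
  calc _ ≤ ‖H b‖ * ‖F b‖ + ‖H a‖ * ‖F a‖ + ‖∫ x in a..b, H' x * F x‖ := by
        refine (norm_sub_le _ _).trans (add_le_add ((norm_sub_le _ _).trans ?_) le_rfl)
        rw [norm_mul, norm_mul]
    _ ≤ ‖H b‖ * D + ‖H a‖ * D + (∫ x in a..b, ‖H' x‖) * D := by
        gcongr
        exacts [hF b (ha.trans hab), hF a ha]
    _ = _ := by ring

/-! ### Extension of smooth functions from a compact interval -/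

/-- Extend the derivative inductively and integrate it; a continuous function is extended by
constants. One-sided derivatives can then be replaced by ordinary ones on the whole line. -/
theorem exists_contDiff_eqOn_Icc {b : ℝ} (hb : 0 < b) (n : ℕ) {f : ℝ → ℂ}
    (hf : ContDiffOn ℝ (n : WithTop ℕ∞) f (Icc 0 b)) :
    ∃ F : ℝ → ℂ, ContDiff ℝ (n : WithTop ℕ∞) F ∧ EqOn F f (Icc 0 b) := by
  induction n generalizing f with
  | zero =>
    have hc : ContinuousOn f (Icc 0 b) := hf.continuousOn
    refine ⟨IccExtend hb.le ((Icc 0 b).domRestrict f), ?_, fun x hx => ?_⟩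
    · exact contDiff_zero.2 (continuousOn_iff_continuous_domRestrict.1 hc).Icc_extend'
    · rw [IccExtend_of_mem _ _ hx]
      rfl
  | succ n ih =>
    have hf' := hf
    push_cast at hf'
    obtain ⟨hd, -, hd'⟩ := (contDiffOn_succ_iff_derivWithin (uniqueDiffOn_Icc hb)).1 hf'
    obtain ⟨G, hG, hGe⟩ := ih hd'
    have hFd : ∀ x, HasDerivAt (fun x => f 0 + ∫ t in (0 : ℝ)..x, G t) (G x) x := fun x =>
      (hG.continuous.integral_hasStrictDerivAt 0 x).hasDerivAt.const_add _
    refine ⟨fun x => f 0 + ∫ t in (0 : ℝ)..x, G t, ?_, fun x hx => ?_⟩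
    · push_cast
      refine contDiff_succ_iff_deriv.2 ⟨fun x => (hFd x).differentiableAt, by simp, ?_⟩
      rwa [show deriv (fun x => f 0 + ∫ t in (0 : ℝ)..x, G t) = G from
        funext fun x => (hFd x).deriv]
    · have := intervalIntegral.integral_eq_sub_of_hasDerivAt_of_le (f := f) (f' := G) hx.1
        (hf.continuousOn.mono (Icc_subset_Icc_right hx.2)) (fun t ht => ?_)
        (hG.continuous.intervalIntegrable _ _)
      · simp [this]
      · have ht' : t ∈ Icc 0 b := ⟨ht.1.le, ht.2.le.trans hx.2⟩
        rw [hGe ht']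
        exact (hd t ht').hasDerivWithinAt.hasDerivAt
          (Icc_mem_nhds ht.1 (ht.2.trans_le hx.2))

/-! ### Division of a smooth function by the variable -/

/-- The moment `∫_0^1 t^k h(tx) dt`. -/
noncomputable def moment (k : ℕ) (h : ℝ → ℂ) (x : ℝ) : ℂ :=
  ∫ t in (0 : ℝ)..1, (t : ℂ) ^ k * h (t * x)

theorem continuous_moment (k : ℕ) {h : ℝ → ℂ} (hh : Continuous h) : Continuous (moment k h) := by
  refine intervalIntegral.continuous_parametric_intervalIntegral_of_continuous' ?_ 0 1
  simp only [Function.uncurry_def]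
  fun_prop

/-- Differentiation under the integral brings down one factor t. Keeping general k makes the family
stable, so smoothness of every order follows by induction. -/
theorem hasDerivAt_moment (k : ℕ) {h : ℝ → ℂ} (hh : ContDiff ℝ 1 h) (x : ℝ) :
    HasDerivAt (moment k h) (moment (k + 1) (deriv h) x) x := by
  have hdc : Continuous (deriv h) := hh.continuous_deriv le_rfl
  have hhc := hh.continuous
  obtain ⟨C, hC⟩ := isCompact_Icc.exists_bound_of_continuousOn
    (s := Icc (-(|x| + 1)) (|x| + 1)) hdc.continuousOn
  refine (intervalIntegral.hasDerivAt_integral_of_dominated_loc_of_deriv_le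
    (F := fun (x t : ℝ) => (t : ℂ) ^ k * h (t * x))
    (F' := fun (x t : ℝ) => (t : ℂ) ^ (k + 1) * deriv h (t * x)) (x₀ := x)
    (bound := fun _ => C) (a := 0) (b := 1) (μ := volume)
    (Metric.ball_mem_nhds x one_pos) ?_ ?_ ?_ ?_ ?_ ?_).2
  · exact .of_forall fun y => Continuous.aestronglyMeasurable (by fun_prop)
  · exact Continuous.intervalIntegrable (by fun_prop) _ _
  · exact Continuous.aestronglyMeasurable (by fun_prop)
  · refine .of_forall fun t ht y hy => ?_
    rw [uIoc_of_le zero_le_one] at ht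
    have hy' : |y| ≤ |x| + 1 := by
      have h1 : |y - x| < 1 := by simpa [Real.dist_eq] using Metric.mem_ball.1 hy
      have h2 := abs_sub_abs_le_abs_sub y x
      linarith
    have hty : |t * y| ≤ |x| + 1 := by
      rw [abs_mul, abs_of_pos ht.1]
      exact (mul_le_of_le_one_left (abs_nonneg y) ht.2).trans hy'
    rw [norm_mul, norm_pow, Complex.norm_real, Real.norm_of_nonneg ht.1.le]
    exact (mul_le_of_le_one_left (norm_nonneg _) (pow_le_one₀ ht.1.le ht.2)).trans
      (hC _ (abs_le.1 hty))
  · exact intervalIntegrable_const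
  · refine .of_forall fun t _ y _ => ?_
    have h1 : HasDerivAt h (deriv h (t * y)) (t * y) :=
      (hh.differentiable one_ne_zero _).hasDerivAt
    have h2 : HasDerivAt (fun y : ℝ => t * y) t y := by
      simpa using (hasDerivAt_id y).const_mul t
    have h3 := (h1.scomp y h2).const_mul ((t : ℂ) ^ k)
    convert! h3 using 1
    rw [Complex.real_smul]
    ring

theorem contDiff_moment (k n : ℕ) {h : ℝ → ℂ} (hh : ContDiff ℝ (n : WithTop ℕ∞) h) :
    ContDiff ℝ (n : WithTop ℕ∞) (moment k h) := by
  induction n generalizing k h with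
  | zero => exact contDiff_zero.2 (continuous_moment k hh.continuous)
  | succ n ih =>
    have h1 : ContDiff ℝ 1 h := hh.of_le (by exact_mod_cast Nat.le_add_left 1 n)
    push_cast at hh ⊢
    obtain ⟨-, -, hd⟩ := contDiff_succ_iff_deriv.1 hh
    refine contDiff_succ_iff_deriv.2
      ⟨fun x => (hasDerivAt_moment k h1 x).differentiableAt, by simp, ?_⟩
    rw [show deriv (moment k h) = moment (k + 1) (deriv h) from
      funext fun x => (hasDerivAt_moment k h1 x).deriv]
    exact ih (k + 1) hd

/-- The quotient `g(x)/x`, extended continuously to `0`, for `g` with `g(0) = 0`. -/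
noncomputable def divX (g : ℝ → ℂ) : ℝ → ℂ := moment 0 (deriv g)

theorem contDiff_divX (n : ℕ) {g : ℝ → ℂ} (hg : ContDiff ℝ (n + 1 : ℕ) g) :
    ContDiff ℝ (n : WithTop ℕ∞) (divX g) := by
  push_cast at hg
  exact contDiff_moment 0 n (contDiff_succ_iff_deriv.1 hg).2.2

/-- Hadamard's lemma: g(x) - g(0) is the integral over [0,1] of the t-derivative of g(tx). -/
theorem mul_divX {g : ℝ → ℂ} (hg : ContDiff ℝ 1 g) (h0 : g 0 = 0) (x : ℝ) :
    (x : ℂ) * divX g x = g x := by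
  have hdc : Continuous (deriv g) := hg.continuous_deriv le_rfl
  have hd : ∀ t ∈ uIcc (0 : ℝ) 1,
      HasDerivAt (fun t : ℝ => g (t * x)) ((x : ℂ) * deriv g (t * x)) t := by
    intro t _
    have h1 : HasDerivAt g (deriv g (t * x)) (t * x) :=
      (hg.differentiable one_ne_zero _).hasDerivAt
    have h2 : HasDerivAt (fun t : ℝ => t * x) x t := by
      simpa using (hasDerivAt_id t).mul_const x
    exact h1.scomp t h2
  have := intervalIntegral.integral_eq_sub_of_hasDerivAt hd
    (Continuous.intervalIntegrable (by fun_prop) _ _)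
  rw [intervalIntegral.integral_const_mul] at this
  simpa [divX, moment, h0] using this

/-! ### Functions vanishing to a given order at both endpoints -/

/-- `g` is of class `C^{n+1}`, and its derivatives of order less than `n` vanish at `0` and `b`. -/
structure VanishesAtEnds (b : ℝ) (n : ℕ) (g : ℝ → ℂ) : Prop where
  contDiff : ContDiff ℝ (n + 1 : ℕ) g
  left : ∀ k < n, iteratedDeriv k g 0 = 0
  right : ∀ k < n, iteratedDeriv k g b = 0

/-- Leibniz's rule with a linear factor. At k = 0 the truncated index k - 1 is harmless, its
coefficient being 0. -/
theorem iteratedDeriv_id_mul (k : ℕ) {D : ℝ → ℂ} (hD : ContDiff ℝ (k : WithTop ℕ∞) D) (x : ℝ) :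
    iteratedDeriv k (fun x : ℝ => (x : ℂ) * D x) x =
      x * iteratedDeriv k D x + k * iteratedDeriv (k - 1) D x := by
  induction k generalizing D with
  | zero => simp
  | succ k ih =>
    have h1 : ContDiff ℝ 1 D := hD.of_le (by exact_mod_cast Nat.le_add_left 1 k)
    have hDk : ContDiff ℝ (k : WithTop ℕ∞) D := hD.of_le (by exact_mod_cast Nat.le_succ k)
    push_cast at hD
    have hd := (contDiff_succ_iff_deriv.1 hD).2.2
    have e : deriv (fun x : ℝ => (x : ℂ) * D x) = D + fun x : ℝ => (x : ℂ) * deriv D x := by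
      funext x
      have h2 := (Complex.ofRealCLM.hasDerivAt (x := x)).mul
        (h1.differentiable one_ne_zero x).hasDerivAt
      have h3 : HasDerivAt (fun x : ℝ => (x : ℂ) * D x) (1 * D x + x * deriv D x) x := by
        simpa using! h2
      simpa using h3.deriv
    have hm : ContDiff ℝ (k : WithTop ℕ∞) fun x : ℝ => (x : ℂ) * deriv D x :=
      (Complex.ofRealCLM.contDiff).mul hd
    rw [iteratedDeriv_succ', e, iteratedDeriv_add hDk.contDiffAt hm.contDiffAt, ih hd,
      ← iteratedDeriv_succ']
    rcases k with _ | k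
    · simp [add_comm]
    · simp only [Nat.add_sub_cancel, ← iteratedDeriv_succ']
      push_cast
      ring

namespace VanishesAtEnds

variable {b : ℝ} {n : ℕ} {g h : ℝ → ℂ}

theorem contDiff_one (hg : VanishesAtEnds b n g) : ContDiff ℝ 1 g :=
  hg.contDiff.of_le (by exact_mod_cast Nat.le_add_left 1 n)

theorem apply_zero (hg : VanishesAtEnds b (n + 1) g) : g 0 = 0 := by
  simpa using hg.left 0 n.succ_pos

theorem apply_right (hg : VanishesAtEnds b (n + 1) g) : g b = 0 := by
  simpa using hg.right 0 n.succ_pos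

theorem deriv (hg : VanishesAtEnds b (n + 1) g) : VanishesAtEnds b n (deriv g) where
  contDiff := by
    have := hg.contDiff
    push_cast at this ⊢
    exact (contDiff_succ_iff_deriv.1 this).2.2
  left k hk := by rw [← iteratedDeriv_succ']; exact hg.left _ (by omega)
  right k hk := by rw [← iteratedDeriv_succ']; exact hg.right _ (by omega)

theorem const_mul_add (c : ℂ) (hg : VanishesAtEnds b n g) (hh : VanishesAtEnds b n h) :
    VanishesAtEnds b n (fun x => c * g x + h x) := by
  have hcg : ContDiff ℝ (n + 1 : ℕ) fun x => c * g x := contDiff_const.mul hg.contDiff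
  have e : ∀ k < n, ∀ x, iteratedDeriv k (fun x => c * g x + h x) x =
      c * iteratedDeriv k g x + iteratedDeriv k h x := by
    intro k hk x
    have hkn : (k : WithTop ℕ∞) ≤ (n + 1 : ℕ) := by exact_mod_cast by omega
    rw [iteratedDeriv_fun_add (hcg.of_le hkn).contDiffAt (hh.contDiff.of_le hkn).contDiffAt,
      iteratedDeriv_const_mul_field]
  exact ⟨hcg.add hh.contDiff, fun k hk => by rw [e k hk, hg.left k hk, hh.left k hk]; simp,
    fun k hk => by rw [e k hk, hg.right k hk, hh.right k hk]; simp⟩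

/-- Apply Leibniz's rule to g = xD. At 0, order k+1 reads (k+1)D^{(k)}(0) = 0, which costs one order
of vanishing. At b, order k expresses b·D^{(k)}(b) through D^{(k-1)}(b), so induction on k works. -/
theorem divX (hb : b ≠ 0) (hg : VanishesAtEnds b (n + 1) g) : VanishesAtEnds b n (divX g) := by
  have hD := contDiff_divX (n + 1) hg.contDiff
  have e : ∀ k ≤ n + 1, ∀ x : ℝ, iteratedDeriv k g x =
      x * iteratedDeriv k (HCCF.divX g) x + k * iteratedDeriv (k - 1) (HCCF.divX g) x := by
    intro k hk x
    rw [← iteratedDeriv_id_mul k (hD.of_le (by exact_mod_cast hk))]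
    congr 1
    exact (funext fun x => (mul_divX hg.contDiff_one hg.apply_zero x)).symm
  refine ⟨hD, fun k hk => ?_, fun k hk => ?_⟩
  · have := e (k + 1) (by omega) 0
    rw [hg.left _ (by omega)] at this
    have hk0 : (k : ℂ) + 1 ≠ 0 := by exact_mod_cast k.succ_ne_zero
    simpa [hk0] using this.symm
  · have hb' : (b : ℂ) ≠ 0 := by exact_mod_cast hb
    induction k with
    | zero =>
      have := e 0 (by omega) b
      rw [hg.right _ (by omega)] at this
      simpa [hb'] using this.symm
    | succ k ih =>
      have := e (k + 1) (by omega) b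
      rw [hg.right _ (by omega), Nat.add_sub_cancel, ih (by omega)] at this
      simpa [hb'] using this.symm

end VanishesAtEnds

/-! ### The interpolation error -/

theorem contDiff_eval_ofReal (P : ℂ[X]) (n : WithTop ℕ∞) :
    ContDiff ℝ n fun x : ℝ => P.eval (x : ℂ) :=
  (P.contDiff_aeval (R := ℂ) (𝕜 := ℂ) n).restrict_scalars ℝ |>.comp Complex.ofRealCLM.contDiff

theorem iteratedDeriv_eval_ofReal (P : ℂ[X]) (k : ℕ) (x : ℝ) :
    iteratedDeriv k (fun x : ℝ => P.eval (x : ℂ)) x = (Polynomial.derivative^[k] P).eval (x : ℂ) := by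
  induction k generalizing P with
  | zero => simp
  | succ k ih =>
    rw [iteratedDeriv_succ', Function.iterate_succ_apply, ← ih]
    congr 1
    exact funext fun x => (P.hasDerivAt (x : ℂ)).comp_ofReal.deriv

/-- Subtract P from a C^{s+2} extension of f. The smoothness s+2 is what lets s+1 reductions end at
a C¹ amplitude. -/
theorem exists_vanishesAtEnds_eqOn_sub {b : ℝ} (hb : 0 < b) {N s : ℕ} (hN : 1 ≤ N) {f : ℝ → ℂ}
    (hf : ContDiffOn ℝ ((s + 2 : ℕ) : WithTop ℕ∞) f (Icc 0 b)) :
    ∃ g, VanishesAtEnds b (s + 1) g ∧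
      ∀ x ∈ Icc 0 b, f x - hermiteFun b N s f x = g x := by
  obtain ⟨F, hF, hFe⟩ := exists_contDiff_eqOn_Icc hb (s + 2) hf
  have hP := isHermiteInterpolant_hermiteInterpolant hb hN s f
  have hPc := contDiff_eval_ofReal (hermiteInterpolant b N s f)
  have e : ∀ k < s + 1, ∀ x ∈ Icc 0 b,
      iteratedDeriv k (fun x => F x - hermiteFun b N s f x) x =
      iteratedDerivWithin k f (Icc 0 b) x -
        (Polynomial.derivative^[k] (hermiteInterpolant b N s f)).eval (x : ℂ) := by
    intro k hk x hx
    have hFk : ContDiff ℝ (k : WithTop ℕ∞) F := hF.of_le (by exact_mod_cast by omega)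
    have h1 := iteratedDeriv_fun_sub (x := x) hFk.contDiffAt (hPc k).contDiffAt
    unfold hermiteFun
    rw [h1, iteratedDeriv_eval_ofReal,
      ← iteratedDerivWithin_eq_iteratedDeriv (uniqueDiffOn_Icc hb) hFk.contDiffAt hx,
      iteratedDerivWithin_congr hFe hx]
  refine ⟨fun x => F x - hermiteFun b N s f x, ⟨hF.sub (hPc _), fun k hk => ?_, fun k hk => ?_⟩,
    fun x hx => by simp only [hFe hx]⟩
  · rw [e k hk 0 ⟨le_rfl, hb.le⟩, Complex.ofReal_zero, hP.left k (by omega), sub_self]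
  · rw [e k hk b ⟨hb.le, le_rfl⟩, hP.right k (by omega), sub_self]

/-! ### Decay of the integrals without vanishing conditions -/

/-- The variation bound with H = w·h on all of [0,b]. It serves w = 1, x^α and x^α ln x, the last
two with α > 0 and β = 0. -/
theorem exists_norm_integral_weight_mul_besselKernel_le {β b : ℝ} {ν : ℂ} (hν : -1 < ν.re)
    (hβ : β ≤ 0) (hβν : -1 < β + ν.re) (hb : 0 ≤ b) {w w' : ℝ → ℝ} (hw : ContinuousOn w (Icc 0 b))
    (hw' : ∀ x ∈ Ioo 0 b, HasDerivAt w (w' x) x) (hwi : IntervalIntegrable w' volume 0 b)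
    {h : ℝ → ℂ} (hh : ContDiff ℝ 1 h) :
    ∃ K, ∀ ω : ℝ, 0 < ω →
      ‖∫ x in (0 : ℝ)..b, ((w x : ℂ) * h x) * besselKernel β ν ω x‖ ≤ K * ω ^ (-β - 1) := by
  obtain ⟨M, hM0, hM⟩ := exists_norm_integral_mul_besselKernel_le hν hβ hβν
  have hdc : Continuous (deriv h) := hh.continuous_deriv le_rfl
  have hwc : ContinuousOn (fun x => (w x : ℂ)) (Icc 0 b) :=
    Complex.continuous_ofReal.comp_continuousOn hw
  set H : ℝ → ℂ := fun x => (w x : ℂ) * h x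
  set H' : ℝ → ℂ := fun x => (w' x : ℂ) * h x + (w x : ℂ) * deriv h x
  refine ⟨M * (‖H b‖ + ‖H 0‖ + ∫ x in (0 : ℝ)..b, ‖H' x‖), fun ω hω => ?_⟩
  refine (hM ω hω 0 b le_rfl hb H H' (hwc.mul hh.continuous.continuousOn) ?_ ?_).trans
    (le_of_eq (by ring))
  · exact fun x hx => (hw' x hx).ofReal_comp.mul (hh.differentiable one_ne_zero x).hasDerivAt
  · have h1 : IntervalIntegrable (fun x => (w' x : ℂ)) volume 0 b :=
      ⟨hwi.1.ofReal, hwi.2.ofReal⟩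
    refine (h1.mul_continuousOn hh.continuous.continuousOn).add
      (ContinuousOn.intervalIntegrable ?_)
    rw [uIcc_of_le hb]
    exact hwc.mul hdc.continuousOn

theorem rpow_neg_sub_one {α ω : ℝ} (hω : 0 < ω) : ω ^ (-α - 1) = 1 / ω ^ (α + 1) := by
  rw [one_div, ← Real.rpow_neg hω.le]
  congr 1
  ring

theorem exists_norm_I₁_le {α b : ℝ} {ν : ℂ} (hν : -1 < ν.re) (hαν : -1 < α + ν.re)
    (hb : 0 < b) {h : ℝ → ℂ} (hh : ContDiff ℝ 1 h) :
    ∃ K, ∀ ω : ℝ, 1 ≤ ω → ‖I₁ α b ν ω h‖ ≤ K * C₁ α ω := by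
  rcases le_or_gt α 0 with hα | hα
  · obtain ⟨K, hK⟩ := exists_norm_integral_weight_mul_besselKernel_le hν hα hαν hb.le
      (w := fun _ => 1) (w' := fun _ => 0) continuousOn_const (fun x _ => hasDerivAt_const x 1)
      intervalIntegrable_const hh
    refine ⟨K, fun ω hω => ?_⟩
    have hω0 : 0 < ω := zero_lt_one.trans_le hω
    have e : C₁ α ω = ω ^ (-α - 1) := by
      rw [rpow_neg_sub_one hω0, C₁]
      split_ifs with h0
      · rfl
      -- At α = 0 both rates equal 1/ω, so this value may be treated with the singular case.
      · rw [le_antisymm hα (not_lt.1 h0)]; simp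
    rw [e]
    refine le_trans (le_of_eq ?_) (hK ω hω0)
    rw [I₁]
    congr 1
    refine intervalIntegral.integral_congr fun x _ => ?_
    simp only [integrand₁, besselKernel, Complex.ofReal_one]
    ring
  · obtain ⟨K, hK⟩ := exists_norm_integral_weight_mul_besselKernel_le hν le_rfl (by simpa using hν)
      hb.le (w := fun x => x ^ α) (w' := fun x => α * x ^ (α - 1))
      (Real.continuous_rpow_const hα.le).continuousOn
      (fun x hx => Real.hasDerivAt_rpow_const (.inl hx.1.ne'))
      ((intervalIntegral.intervalIntegrable_rpow' (by linarith)).const_mul α) hh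
    refine ⟨K, fun ω hω => ?_⟩
    have hω0 : 0 < ω := zero_lt_one.trans_le hω
    have e : C₁ α ω = ω ^ (-0 - 1 : ℝ) := by
      rw [rpow_neg_sub_one hω0, C₁, if_neg hα.le.not_gt]; simp
    rw [e]
    refine le_trans (le_of_eq ?_) (hK ω hω0)
    rw [I₁]
    congr 1
    refine intervalIntegral.integral_congr fun x _ => ?_
    simp [integrand₁, besselKernel]

/-- With y = x^α this is y ln y divided by α, and y ln y is continuous at 0. -/
theorem continuousOn_rpow_mul_log {α : ℝ} (hα : 0 < α) :
    ContinuousOn (fun x : ℝ => x ^ α * Real.log x) (Ici 0) := by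
  have h : Continuous fun x : ℝ => α⁻¹ * (x ^ α * Real.log (x ^ α)) :=
    continuous_const.mul (Real.continuous_mul_log.comp (Real.continuous_rpow_const hα.le))
  refine h.continuousOn.congr fun x hx => ?_
  rcases (mem_Ici.1 hx).eq_or_lt with h0 | h0
  · simp [← h0, Real.zero_rpow hα.ne']
  · simp only [Real.log_rpow h0]
    field_simp

theorem hasDerivAt_rpow_mul_log (α : ℝ) {x : ℝ} (hx : 0 < x) :
    HasDerivAt (fun x : ℝ => x ^ α * Real.log x) ((α * (x ^ α * Real.log x) + x ^ α) / x) x := by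
  convert! (Real.hasDerivAt_rpow_const (p := α) (.inl hx.ne')).mul (Real.hasDerivAt_log hx.ne')
    using 1
  rw [Real.rpow_sub_one hx.ne']
  ring

theorem integral_mul_rpow_le {ω c q : ℝ} (hω : 0 < ω) (hc : 0 ≤ c) (hωc : ω * c ≤ 1)
    (hq : -1 < q) : ∫ x in (0 : ℝ)..c, (ω * x) ^ q ≤ ω⁻¹ * (q + 1)⁻¹ := by
  have hq1 : 0 < q + 1 := by linarith
  rw [intervalIntegral.integral_comp_mul_left (fun x => x ^ q) hω.ne', integral_rpow (.inl hq),
    mul_zero, Real.zero_rpow hq1.ne', sub_zero, smul_eq_mul, div_eq_mul_inv]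
  gcongr
  exact mul_le_of_le_one_left (by positivity) (Real.rpow_le_one (by positivity) hωc hq1.le)

theorem intervalIntegrable_mul_rpow {ω c q : ℝ} (hω : 0 < ω) (hc : 0 ≤ c) (hq : -1 < q) :
    IntervalIntegrable (fun x => (ω * x) ^ q) volume 0 c := by
  refine ((intervalIntegral.intervalIntegrable_rpow' hq).const_mul (ω ^ q)).congr fun x hx => ?_
  rw [uIoc_of_le hc] at hx
  exact (Real.mul_rpow hω.le hx.1.le).symm

/-- The contribution of `[0, 1/ω]` to the logarithmic integral. -/
theorem exists_norm_integral_integrand₂_near_zero_le {α b : ℝ} {ν : ℂ} (hν : -1 < ν.re)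
    (hαν : -1 < α + ν.re) {h : ℝ → ℂ} (hh : Continuous h) :
    ∃ K, ∀ ω : ℝ, 1 ≤ ω → ∀ c, 0 ≤ c → c ≤ b → ω * c ≤ 1 →
      ‖∫ x in (0 : ℝ)..c, integrand₂ α ν ω h x‖ ≤ K * ((1 + Real.log ω) * ω ^ (-α - 1)) := by
  obtain ⟨C, hC0, hC⟩ := exists_norm_besselJ_le_rpow hν 1
  obtain ⟨B, hB⟩ := isCompact_Icc.exists_bound_of_continuousOn (s := Icc 0 b) hh.continuousOn
  set p := α + ν.re
  obtain ⟨ε, hε, hεp⟩ : ∃ ε, 0 < ε ∧ -1 < p - ε := ⟨(p + 1) / 2, by linarith, by linarith⟩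
  have hp1 : 0 < p + 1 := by linarith
  have hp2 : 0 < p - ε + 1 := by linarith
  refine ⟨|B| * C * ((p + 1)⁻¹ + ε⁻¹ * (p - ε + 1)⁻¹), fun ω hω c hc hcb hωc => ?_⟩
  have hω0 : 0 < ω := zero_lt_one.trans_le hω
  have hlog : 0 ≤ Real.log ω := Real.log_nonneg hω
  set D := |B| * C * ω ^ (-α)
  have hD : 0 ≤ D := by positivity
  have hi1 := intervalIntegrable_mul_rpow hω0 hc (show -1 < p from hαν)
  have hi2 := intervalIntegrable_mul_rpow hω0 hc hεp
  have hi := ((hi1.const_mul (Real.log ω)).add (hi2.const_mul ε⁻¹)).const_mul D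
  refine (intervalIntegral.norm_integral_le_of_norm_le hc (.of_forall fun x hx => ?_) hi).trans ?_
  · have hx0 := hx.1
    have hωx : 0 < ω * x := by positivity
    have hωx1 : ω * x ≤ 1 := le_trans (by gcongr; exact hx.2) hωc
    -- Here x ≤ 1, so |ln x| = ln ω - ln(ωx). The first part gives the logarithmic loss; the second
    -- costs a small power of the scaled variable, still integrable by the choice of ε.
    have hlx : |Real.log x| ≤ Real.log ω + ε⁻¹ * (ω * x) ^ (-ε) := by
      have h1 := Real.log_le_rpow_div (inv_pos.2 hωx).le hε
      rw [Real.log_inv, Real.inv_rpow hωx.le, ← Real.rpow_neg hωx.le, div_eq_inv_mul,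
        Real.log_mul hω0.ne' hx0.ne'] at h1
      have hx1 : x ≤ 1 := le_trans (le_mul_of_one_le_left hx0.le hω) hωx1
      rw [abs_of_nonpos (Real.log_nonpos hx0.le hx1)]
      linarith
    have hBx : ‖h x‖ ≤ |B| := (hB x ⟨hx0.le, hx.2.trans hcb⟩).trans (le_abs_self B)
    have hxα : 0 ≤ x ^ α := by positivity
    have hωα : x ^ α = ω ^ (-α) * (ω * x) ^ α := by
      rw [Real.mul_rpow hω0.le hx0.le, ← mul_assoc, ← Real.rpow_add hω0]; simp
    rw [integrand₂, norm_mul, norm_mul, Complex.norm_real, norm_mul, Real.norm_of_nonneg hxα,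
      Real.norm_eq_abs]
    calc x ^ α * |Real.log x| * ‖h x‖ * ‖besselJ ν ((ω * x : ℝ) : ℂ)‖
        ≤ x ^ α * (Real.log ω + ε⁻¹ * (ω * x) ^ (-ε)) * |B| * (C * (ω * x) ^ ν.re) := by
          gcongr
          exact hC _ hωx hωx1
      _ = D * (Real.log ω * ((ω * x) ^ α * (ω * x) ^ ν.re) +
            ε⁻¹ * ((ω * x) ^ α * (ω * x) ^ ν.re * (ω * x) ^ (-ε))) := by
          rw [hωα]; ring
      _ = D * (Real.log ω * (ω * x) ^ p + ε⁻¹ * (ω * x) ^ (p - ε)) := by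
          rw [← Real.rpow_add hωx, ← Real.rpow_add hωx, ← sub_eq_add_neg]
  · have e : ω ^ (-α - 1) = ω ^ (-α) * ω⁻¹ := by
      rw [Real.rpow_sub_one hω0.ne', div_eq_mul_inv]
    rw [intervalIntegral.integral_const_mul, intervalIntegral.integral_add (hi1.const_mul _)
      (hi2.const_mul _), intervalIntegral.integral_const_mul, intervalIntegral.integral_const_mul]
    have hl2 : Real.log ω ≤ 1 + Real.log ω := by linarith
    have hl1 : 1 ≤ 1 + Real.log ω := by linarith
    calc _ ≤ D * (Real.log ω * (ω⁻¹ * (p + 1)⁻¹) + ε⁻¹ * (ω⁻¹ * (p - ε + 1)⁻¹)) := by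
          gcongr
          exacts [integral_mul_rpow_le hω0 hc hωc hαν, integral_mul_rpow_le hω0 hc hωc hεp]
      _ ≤ D * ((1 + Real.log ω) * (ω⁻¹ * (p + 1)⁻¹) +
            (1 + Real.log ω) * (ε⁻¹ * (ω⁻¹ * (p - ε + 1)⁻¹))) := by
          refine mul_le_mul_of_nonneg_left (add_le_add ?_ ?_) hD
          · gcongr
          · exact le_mul_of_one_le_left (mul_nonneg (inv_nonneg.2 hε.le)
              (mul_nonneg (inv_nonneg.2 hω0.le) (inv_nonneg.2 hp2.le))) hl1
      _ = _ := by rw [e]; ring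

/-- The contribution of `[1/ω, b]` to the logarithmic integral. -/
theorem exists_norm_integral_integrand₂_away_le {α b : ℝ} {ν : ℂ} (hν : -1 < ν.re) (hα : α ≤ 0)
    (hαν : -1 < α + ν.re) (hb : 0 < b) {h : ℝ → ℂ} (hh : ContDiff ℝ 1 h) :
    ∃ K, ∀ ω : ℝ, 1 ≤ ω → ω⁻¹ ≤ b →
      ‖∫ x in ω⁻¹..b, integrand₂ α ν ω h x‖ ≤ K * ((1 + Real.log ω) * ω ^ (-α - 1)) := by
  obtain ⟨M, hM0, hM⟩ := exists_norm_integral_mul_besselKernel_le hν hα hαν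
  have hdc : Continuous (deriv h) := hh.continuous_deriv le_rfl
  obtain ⟨B, hB⟩ := isCompact_Icc.exists_bound_of_continuousOn (s := Icc 0 b)
    hh.continuous.continuousOn
  obtain ⟨B', hB'⟩ := isCompact_Icc.exists_bound_of_continuousOn (s := Icc 0 b) hdc.continuousOn
  have hB0 : 0 ≤ B := (norm_nonneg _).trans (hB 0 ⟨le_rfl, hb.le⟩)
  have hB'0 : 0 ≤ B' := (norm_nonneg _).trans (hB' 0 ⟨le_rfl, hb.le⟩)
  set L := ∫ x in (0 : ℝ)..b, |Real.log x|
  have hlogi : IntervalIntegrable (fun x => |Real.log x|) volume 0 b :=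
    intervalIntegral.intervalIntegrable_log'.abs
  have hL : 0 ≤ L := intervalIntegral.integral_nonneg hb.le fun _ _ => abs_nonneg _
  -- The endpoint values of H = ln(x)h contribute B|ln b| + B ln ω. Its variation contributes the
  -- same again, through the integral of 1/x, plus B'L from h'.
  refine ⟨M * (2 * B * |Real.log b| + 2 * B + B' * L), fun ω hω hωb => ?_⟩
  have hω0 : 0 < ω := zero_lt_one.trans_le hω
  have hc0 : 0 < ω⁻¹ := inv_pos.2 hω0
  have hlog : 0 ≤ Real.log ω := Real.log_nonneg hω
  set H : ℝ → ℂ := fun x => (Real.log x : ℂ) * h x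
  set H' : ℝ → ℂ := fun x => ((x⁻¹ : ℝ) : ℂ) * h x + (Real.log x : ℂ) * deriv h x
  have hsub : uIcc ω⁻¹ b ⊆ Ioi 0 := by
    rw [uIcc_of_le hωb]
    exact fun x hx => hc0.trans_le hx.1
  have hsub' : Icc ω⁻¹ b ⊆ Ioi 0 := by rwa [uIcc_of_le hωb] at hsub
  have hlogc : ContinuousOn (fun x : ℝ => (Real.log x : ℂ)) (Ioi 0) :=
    Complex.continuous_ofReal.comp_continuousOn continuousOn_log_Ioi
  have hinvc : ContinuousOn (fun x : ℝ => x⁻¹) (Ioi 0) :=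
    continuousOn_inv₀.mono fun x hx => ne_of_gt hx
  have hH'c : ContinuousOn H' (Ioi 0) :=
    ((Complex.continuous_ofReal.comp_continuousOn hinvc).mul hh.continuous.continuousOn).add
      (hlogc.mul hdc.continuousOn)
  have key := hM ω hω0 ω⁻¹ b hc0.le hωb H H' ((hlogc.mul hh.continuous.continuousOn).mono hsub')
    (fun x hx => (Real.hasDerivAt_log (hc0.trans hx.1).ne').ofReal_comp.mul
      (hh.differentiable one_ne_zero x).hasDerivAt) ((hH'c.mono hsub).intervalIntegrable)
  have e : ∫ x in ω⁻¹..b, integrand₂ α ν ω h x = ∫ x in ω⁻¹..b, H x * besselKernel α ν ω x := by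
    refine intervalIntegral.integral_congr fun x _ => ?_
    simp only [integrand₂, H, besselKernel]
    push_cast
    ring
  rw [e]
  refine key.trans ?_
  have h1 : ‖H b‖ ≤ B * |Real.log b| := by
    simp only [H]
    rw [norm_mul, Complex.norm_real, Real.norm_eq_abs, mul_comm]
    gcongr
    exact hB b ⟨hb.le, le_rfl⟩
  have h2 : ‖H ω⁻¹‖ ≤ B * Real.log ω := by
    simp only [H]
    rw [norm_mul, Complex.norm_real, Real.log_inv, norm_neg, Real.norm_of_nonneg hlog, mul_comm]
    gcongr
    exact hB _ ⟨hc0.le, hωb⟩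
  have hii : IntervalIntegrable (fun x : ℝ => x⁻¹) volume ω⁻¹ b :=
    (hinvc.mono hsub).intervalIntegrable
  have hli : IntervalIntegrable (fun x => |Real.log x|) volume ω⁻¹ b :=
    (continuousOn_log_Ioi.abs.mono hsub).intervalIntegrable
  have h3 : ∫ x in ω⁻¹..b, ‖H' x‖ ≤ B * (|Real.log b| + Real.log ω) + B' * L := by
    have h4 : ∫ x in ω⁻¹..b, ‖H' x‖ ≤ ∫ x in ω⁻¹..b, (B * x⁻¹ + B' * |Real.log x|) := by
      refine intervalIntegral.integral_mono_on hωb ((hH'c.mono hsub).intervalIntegrable.norm)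
        ((hii.const_mul B).add (hli.const_mul B')) fun x hx => ?_
      have hx0 : 0 < x := hc0.trans_le hx.1
      refine (norm_add_le _ _).trans (add_le_add ?_ ?_)
      · rw [norm_mul, Complex.norm_real, Real.norm_of_nonneg (by positivity), mul_comm]
        gcongr
        exact hB x ⟨hx0.le, hx.2⟩
      · rw [norm_mul, Complex.norm_real, Real.norm_eq_abs, mul_comm]
        gcongr
        exact hB' x ⟨hx0.le, hx.2⟩
    refine h4.trans ?_
    rw [intervalIntegral.integral_add (hii.const_mul B) (hli.const_mul B'),
      intervalIntegral.integral_const_mul, intervalIntegral.integral_const_mul,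
      integral_inv_of_pos hc0 hb, div_inv_eq_mul, Real.log_mul hb.ne' hω0.ne']
    gcongr
    · exact le_abs_self _
    · exact intervalIntegral.integral_mono_interval hc0.le hωb le_rfl
        (.of_forall fun _ => abs_nonneg _) hlogi
  have h5 : ‖H b‖ + ‖H ω⁻¹‖ + ∫ x in ω⁻¹..b, ‖H' x‖ ≤
      (2 * B * |Real.log b| + 2 * B + B' * L) * (1 + Real.log ω) := by
    have : 0 ≤ (2 * B * |Real.log b| + B' * L) * Real.log ω := by positivity
    nlinarith
  calc _ ≤ M * ω ^ (-α - 1) * ((2 * B * |Real.log b| + 2 * B + B' * L) * (1 + Real.log ω)) := by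
        gcongr
    _ = _ := by ring

theorem exists_norm_I₂_le {α b : ℝ} {ν : ℂ} (hν : -1 < ν.re) (hαν : -1 < α + ν.re)
    (hb : 0 < b) {h : ℝ → ℂ} (hh : ContDiff ℝ 1 h) :
    ∃ K, ∀ ω : ℝ, 1 ≤ ω → ‖I₂ α b ν ω h‖ ≤ K * C₂ α ω := by
  rcases le_or_gt α 0 with hα | hα
  · obtain ⟨K, hK⟩ := exists_norm_integral_integrand₂_near_zero_le (b := b) hν hαν hh.continuous
    obtain ⟨K', hK'⟩ := exists_norm_integral_integrand₂_away_le hν hα hαν hb hh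
    refine ⟨K + |K'|, fun ω hω => ?_⟩
    have hω0 : 0 < ω := zero_lt_one.trans_le hω
    have hlog : 0 ≤ Real.log ω := Real.log_nonneg hω
    have e : C₂ α ω = (1 + Real.log ω) * ω ^ (-α - 1) := by
      rw [rpow_neg_sub_one hω0, C₂, if_pos hα, mul_one_div]
    have hD : 0 ≤ (1 + Real.log ω) * ω ^ (-α - 1) := by positivity
    rw [e, I₂, add_mul]
    -- For small ω the cut 1/ω may lie beyond b; the estimate near 0 then covers the whole interval.
    rcases le_total b ω⁻¹ with hbω | hbω
    · refine (hK ω hω b hb.le le_rfl ?_).trans (le_add_of_nonneg_right (by positivity))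
      calc ω * b ≤ ω * ω⁻¹ := by gcongr
        _ = 1 := mul_inv_cancel₀ hω0.ne'
    · have hi := fun (y : ℝ) (hy : 0 ≤ y) => intervalIntegrable_integrand₂ (α := α) hν hαν hy
        (h := h) hh.continuous.continuousOn hω0
      have hc0 : 0 < ω⁻¹ := inv_pos.2 hω0
      rw [← intervalIntegral.integral_add_adjacent_intervals (hi _ hc0.le)
        ((hi _ hc0.le).symm.trans (hi b hb.le))]
      refine (norm_add_le _ _).trans (add_le_add ?_ ?_)
      · exact hK ω hω _ hc0.le hbω (mul_inv_cancel₀ hω0.ne').le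
      · exact (hK' ω hω hbω).trans (by gcongr; exact le_abs_self K')
  · have hi : IntervalIntegrable (fun x : ℝ => (α * (x ^ α * Real.log x) + x ^ α) / x)
        volume 0 b := by
      have h1 := intervalIntegrable_rpow_mul_abs_log (r := α - 1) (by linarith) hb.le
      have h2 : IntervalIntegrable (fun x : ℝ => x ^ (α - 1)) volume 0 b :=
        intervalIntegral.intervalIntegrable_rpow' (by linarith)
      refine intervalIntegrable_of_continuousOn_of_norm_le hb.le ?_ ((h1.const_mul α).add h2) ?_
      · refine ContinuousOn.div ?_ continuousOn_id fun x hx => hx.1.ne'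
        exact ((continuousOn_const.mul ((continuousOn_rpow_Ioi α).mul continuousOn_log_Ioi)).add
          (continuousOn_rpow_Ioi α)).mono fun x hx => hx.1
      · intro x hx _
        have hxα : 0 ≤ x ^ α := by positivity
        rw [norm_div, Real.norm_of_nonneg hx.le, Real.rpow_sub_one hx.ne']
        calc _ ≤ (‖α * (x ^ α * Real.log x)‖ + ‖x ^ α‖) / x := by gcongr; exact norm_add_le _ _
          _ = _ := by
            rw [norm_mul, norm_mul, Real.norm_of_nonneg hα.le, Real.norm_of_nonneg hxα,
              Real.norm_eq_abs]
            ring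
    obtain ⟨K, hK⟩ := exists_norm_integral_weight_mul_besselKernel_le hν le_rfl (by simpa using hν)
      hb.le ((continuousOn_rpow_mul_log hα).mono fun x hx => hx.1)
      (fun x hx => hasDerivAt_rpow_mul_log α hx.1) hi hh
    refine ⟨K, fun ω hω => ?_⟩
    have hω0 : 0 < ω := zero_lt_one.trans_le hω
    have e : C₂ α ω = ω ^ (-0 - 1 : ℝ) := by
      rw [rpow_neg_sub_one hω0, C₂, if_neg hα.not_ge]; simp
    rw [e]
    refine le_trans (le_of_eq ?_) (hK ω hω0)
    rw [I₂]
    congr 1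
    refine intervalIntegral.integral_congr fun x _ => ?_
    simp [integrand₂, besselKernel]

/-! ### Integration by parts against the Bessel function -/

/-- Integration by parts with the recurrence `(x^{ν+1} J_{ν+1})' = x^{ν+1} J_ν`, for a weight `w`
with `x w' = α w + v`. -/
theorem integral_weight_mul_besselJ {α b : ℝ} {ν : ℂ} (hν : -1 < ν.re) (hb : 0 < b) {n : ℕ}
    {g : ℝ → ℂ} (hg : VanishesAtEnds b (n + 1) g) {ω : ℝ} (hω : 0 < ω) {w v : ℝ → ℝ}
    (hw : ∀ x : ℝ, 0 < x → HasDerivAt w ((α * w x + v x) / x) x)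
    (hw0 : Tendsto (fun x => |w x| * x ^ (ν.re + 1)) (𝓝[>] 0) (𝓝 0))
    (hi₁ : IntervalIntegrable (fun x => (w x : ℂ) * g x * besselJ ν ((ω * x : ℝ) : ℂ)) volume 0 b)
    (hi₂ : IntervalIntegrable (fun x => (w x : ℂ) * ((α - ν - 1) * divX g x + deriv g x) *
      besselJ (ν + 1) ((ω * x : ℝ) : ℂ)) volume 0 b)
    (hi₃ : IntervalIntegrable (fun x => (v x : ℂ) * divX g x *
      besselJ (ν + 1) ((ω * x : ℝ) : ℂ)) volume 0 b) :
    (ω : ℂ) * ∫ x in (0 : ℝ)..b, (w x : ℂ) * g x * besselJ ν ((ω * x : ℝ) : ℂ) =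
      -((∫ x in (0 : ℝ)..b, (w x : ℂ) * ((α - ν - 1) * divX g x + deriv g x) *
          besselJ (ν + 1) ((ω * x : ℝ) : ℂ)) +
        ∫ x in (0 : ℝ)..b, (v x : ℂ) * divX g x * besselJ (ν + 1) ((ω * x : ℝ) : ℂ)) := by
  have hν1 := neg_one_lt_re_add_one hν
  have hgc := hg.contDiff_one
  set Φ : ℝ → ℂ := fun x => (w x : ℂ) * g x * besselJ (ν + 1) ((ω * x : ℝ) : ℂ)
  have hd : ∀ x : ℝ, 0 < x → HasDerivAt Φ
      ((ω : ℂ) * ((w x : ℂ) * g x * besselJ ν ((ω * x : ℝ) : ℂ)) +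
        ((w x : ℂ) * ((α - ν - 1) * divX g x + deriv g x) * besselJ (ν + 1) ((ω * x : ℝ) : ℂ) +
        (v x : ℂ) * divX g x * besselJ (ν + 1) ((ω * x : ℝ) : ℂ))) x := by
    intro x hx
    have hx0 : (x : ℂ) ≠ 0 := by exact_mod_cast hx.ne'
    have hω0 : (ω : ℂ) ≠ 0 := by exact_mod_cast hω.ne'
    have h1 : HasDerivAt (fun x : ℝ => ω * x) ω x := by simpa using (hasDerivAt_id x).const_mul ω
    have h2 := (hasDerivAt_besselJ_succ hν (mul_pos hω hx)).scomp x h1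
    have h3 := ((hw x hx).ofReal_comp.mul (hgc.differentiable one_ne_zero x).hasDerivAt).mul h2
    convert! h3 using 1
    simp only [Function.comp_apply, Complex.real_smul, Pi.mul_apply]
    -- The derivatives of w and of J_{ν+1} each carry a factor 1/x; writing g as x times `divX g`
    -- removes it.
    rw [← mul_divX hgc hg.apply_zero x]
    push_cast
    field_simp
    ring
  -- At 0 boundedness of g suffices, since |w| x^{Re ν+1} tends to 0. At b the boundary term
  -- disappears because g(b) = 0.
  have hlim0 : Tendsto Φ (𝓝[>] 0) (𝓝 0) := by
    obtain ⟨C, hC0, hC⟩ := exists_norm_besselJ_le_rpow hν1 (ω * b)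
    obtain ⟨B, hB⟩ := isCompact_Icc.exists_bound_of_continuousOn (s := Icc 0 b)
      hgc.continuous.continuousOn
    have h0 := hw0.const_mul (B * C * ω ^ (ν.re + 1))
    rw [mul_zero] at h0
    refine squeeze_zero_norm' ?_ h0
    filter_upwards [Ioo_mem_nhdsGT hb] with x hx
    have hJ := hC (ω * x) (mul_pos hω hx.1) (mul_le_mul_of_nonneg_left hx.2.le hω.le)
    rw [Complex.add_re, Complex.one_re, Real.mul_rpow hω.le hx.1.le] at hJ
    have hB' := hB x ⟨hx.1.le, hx.2.le⟩
    simp only [Φ]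
    rw [norm_mul, norm_mul, Complex.norm_real, Real.norm_eq_abs]
    calc _ ≤ |w x| * B * (C * (ω ^ (ν.re + 1) * x ^ (ν.re + 1))) := by
          have : 0 ≤ B := (norm_nonneg _).trans hB'
          gcongr
      _ = _ := by ring
  have hlimb : Tendsto Φ (𝓝[<] b) (𝓝 0) := by
    have h := (hd b hb).continuousAt.tendsto
    rw [show Φ b = 0 by simp [Φ, hg.apply_right]] at h
    exact h.mono_left nhdsWithin_le_nhds
  have h := intervalIntegral.integral_eq_sub_of_hasDerivAt_of_tendsto hb
    (fun x hx => hd x hx.1) ((hi₁.const_mul (ω : ℂ)).add (hi₂.add hi₃)) hlim0 hlimb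
  rw [intervalIntegral.integral_add (hi₁.const_mul _) (hi₂.add hi₃),
    intervalIntegral.integral_add hi₂ hi₃, intervalIntegral.integral_const_mul, sub_self] at h
  exact eq_neg_of_add_eq_zero_left h

section Reduction

variable {α b : ℝ} {ν : ℂ} {n : ℕ} {g : ℝ → ℂ} {ω : ℝ}

theorem neg_one_lt_add_re_add_one (hαν : -1 < α + ν.re) : -1 < α + (ν + 1).re := by
  simp only [Complex.add_re, Complex.one_re]; linarith

theorem VanishesAtEnds.reduction (c : ℂ) (hb : b ≠ 0) (hg : VanishesAtEnds b (n + 1) g) :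
    VanishesAtEnds b n fun x => c * HCCF.divX g x + _root_.deriv g x :=
  (hg.divX hb).const_mul_add c hg.deriv

theorem I₁_reduction (hν : -1 < ν.re) (hαν : -1 < α + ν.re) (hb : 0 < b)
    (hg : VanishesAtEnds b (n + 1) g) (hω : 0 < ω) :
    (ω : ℂ) * I₁ α b ν ω g =
      -I₁ α b (ν + 1) ω (fun x => (α - ν - 1) * divX g x + deriv g x) := by
  have hν1 := neg_one_lt_re_add_one hν
  have hαν1 := neg_one_lt_add_re_add_one hαν
  have hg1 := hg.reduction (α - ν - 1) hb.ne'
  have h := integral_weight_mul_besselJ (α := α) hν hb hg hω (w := fun x => x ^ α) (v := fun _ => 0)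
    ?_ ?_ (intervalIntegrable_integrand₁ hν hαν hb.le hg.contDiff.continuous.continuousOn hω)
    (intervalIntegrable_integrand₁ hν1 hαν1 hb.le hg1.contDiff.continuous.continuousOn hω) (by simp)
  · simp only [Complex.ofReal_zero, zero_mul, intervalIntegral.integral_zero, add_zero] at h
    exact h
  · intro x hx
    convert! Real.hasDerivAt_rpow_const (p := α) (.inl hx.ne') using 1
    rw [Real.rpow_sub_one hx.ne']
    ring
  · have hδ : 0 < α + ν.re + 1 := by linarith
    have h0 : Tendsto (fun x : ℝ => x ^ (α + ν.re + 1)) (𝓝[>] 0) (𝓝 0) := by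
      have := (Real.continuous_rpow_const hδ.le).tendsto 0
      rw [Real.zero_rpow hδ.ne'] at this
      exact this.mono_left nhdsWithin_le_nhds
    refine h0.congr' ?_
    filter_upwards [self_mem_nhdsWithin] with x hx
    have hx : 0 < x := hx
    rw [abs_of_nonneg (by positivity), ← Real.rpow_add hx, add_assoc]

theorem I₂_reduction (hν : -1 < ν.re) (hαν : -1 < α + ν.re) (hb : 0 < b)
    (hg : VanishesAtEnds b (n + 1) g) (hω : 0 < ω) :
    (ω : ℂ) * I₂ α b ν ω g =
      -(I₂ α b (ν + 1) ω (fun x => (α - ν - 1) * divX g x + deriv g x) +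
        I₁ α b (ν + 1) ω (divX g)) := by
  have hν1 := neg_one_lt_re_add_one hν
  have hαν1 := neg_one_lt_add_re_add_one hαν
  have hg1 := hg.reduction (α - ν - 1) hb.ne'
  refine integral_weight_mul_besselJ (α := α) hν hb hg hω (w := fun x => x ^ α * Real.log x)
    (v := fun x => x ^ α) (fun x hx => hasDerivAt_rpow_mul_log α hx)
    ?_ (intervalIntegrable_integrand₂ hν hαν hb.le hg.contDiff.continuous.continuousOn hω)
    (intervalIntegrable_integrand₂ hν1 hαν1 hb.le hg1.contDiff.continuous.continuousOn hω)
    (intervalIntegrable_integrand₁ hν1 hαν1 hb.le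
      (hg.divX hb.ne').contDiff.continuous.continuousOn hω)
  have hδ : 0 < α + ν.re + 1 := by linarith
  have h0 := (tendsto_log_mul_rpow_nhdsGT_zero hδ).abs
  rw [abs_zero] at h0
  refine h0.congr' ?_
  filter_upwards [self_mem_nhdsWithin] with x hx
  have hx : 0 < x := hx
  have hxα : 0 ≤ x ^ α := by positivity
  have hxν : 0 ≤ x ^ (ν.re + 1) := by positivity
  rw [add_assoc, Real.rpow_add hx, abs_mul, abs_mul, abs_mul, abs_of_nonneg hxα,
    abs_of_nonneg hxν]
  ring

theorem C₁_nonneg (hω : 1 ≤ ω) : 0 ≤ C₁ α ω := by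
  rw [C₁]; split_ifs <;> positivity

theorem C₁_le_C₂ (hω : 1 ≤ ω) : C₁ α ω ≤ C₂ α ω := by
  have hlog : 0 ≤ Real.log ω := Real.log_nonneg hω
  rw [C₁, C₂]
  split_ifs with h1 h2 h2
  · gcongr; linarith
  · exact absurd h1.le h2
  · rw [le_antisymm h2 (not_lt.1 h1), zero_add, Real.rpow_one]
    gcongr; linarith
  · rfl

theorem norm_le_div_pow_succ {z y : ℂ} {K c : ℝ} (hω : 0 < ω) (h : (ω : ℂ) * z = -y)
    (hy : ‖y‖ ≤ K * (c / ω ^ n)) : ‖z‖ ≤ K * (c / ω ^ (n + 1)) := by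
  have h1 : ω * ‖z‖ = ‖y‖ := by
    rw [← norm_neg y, ← h, norm_mul, Complex.norm_real, Real.norm_of_nonneg hω.le]
  rw [← mul_le_mul_iff_of_pos_left hω, h1]
  refine hy.trans (le_of_eq ?_)
  rw [pow_succ]
  field_simp

/-- Induction on the order of vanishing, with ν general because each reduction raises it. Since α
never changes, neither does the rate. -/
theorem exists_norm_I₁_le_div_pow (hν : -1 < ν.re) (hαν : -1 < α + ν.re) (hb : 0 < b)
    (hg : VanishesAtEnds b n g) :
    ∃ K, ∀ ω : ℝ, 1 ≤ ω → ‖I₁ α b ν ω g‖ ≤ K * (C₁ α ω / ω ^ n) := by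
  induction n generalizing ν g with
  | zero => simpa using exists_norm_I₁_le hν hαν hb hg.contDiff_one
  | succ n ih =>
    obtain ⟨K, hK⟩ := ih (neg_one_lt_re_add_one hν) (neg_one_lt_add_re_add_one hαν)
      (hg.reduction (α - ν - 1) hb.ne')
    refine ⟨K, fun ω hω => ?_⟩
    have hω0 : 0 < ω := zero_lt_one.trans_le hω
    exact norm_le_div_pow_succ hω0 (I₁_reduction hν hαν hb hg hω0) (hK ω hω)

/-- The extra term of each reduction has no logarithm and amplitude `divX g`, which vanishes to
order n; the bound for `I₁` applies to it, and C₁ ≤ C₂. -/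
theorem exists_norm_I₂_le_div_pow (hν : -1 < ν.re) (hαν : -1 < α + ν.re) (hb : 0 < b)
    (hg : VanishesAtEnds b n g) :
    ∃ K, ∀ ω : ℝ, 1 ≤ ω → ‖I₂ α b ν ω g‖ ≤ K * (C₂ α ω / ω ^ n) := by
  induction n generalizing ν g with
  | zero => simpa using exists_norm_I₂_le hν hαν hb hg.contDiff_one
  | succ n ih =>
    have hν1 := neg_one_lt_re_add_one hν
    have hαν1 := neg_one_lt_add_re_add_one hαν
    obtain ⟨K, hK⟩ := ih hν1 hαν1 (hg.reduction (α - ν - 1) hb.ne')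
    obtain ⟨K', hK'⟩ := exists_norm_I₁_le_div_pow hν1 hαν1 hb (hg.divX hb.ne')
    refine ⟨K + |K'|, fun ω hω => ?_⟩
    have hω0 : 0 < ω := zero_lt_one.trans_le hω
    refine norm_le_div_pow_succ hω0 (I₂_reduction hν hαν hb hg hω0) ?_
    rw [add_mul]
    refine (norm_add_le _ _).trans (add_le_add (hK ω hω) ((hK' ω hω).trans ?_))
    have := C₁_nonneg (α := α) hω
    gcongr
    exacts [le_abs_self K', C₁_le_C₂ hω]

end Reduction

/-! ### Linearity in the amplitude -/

theorem I₁_sub {α b ω : ℝ} {m : ℂ} (hb : 0 ≤ b) {f p g : ℝ → ℂ}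
    (hf : IntervalIntegrable (integrand₁ α m ω f) volume 0 b)
    (hp : IntervalIntegrable (integrand₁ α m ω p) volume 0 b)
    (hg : ∀ x ∈ Icc 0 b, f x - p x = g x) : I₁ α b m ω f - I₁ α b m ω p = I₁ α b m ω g := by
  rw [I₁, I₁, ← intervalIntegral.integral_sub hf hp]
  refine intervalIntegral.integral_congr fun x hx => ?_
  rw [uIcc_of_le hb] at hx
  simp only [integrand₁, ← hg x hx]
  ring

theorem I₂_sub {α b ω : ℝ} {m : ℂ} (hb : 0 ≤ b) {f p g : ℝ → ℂ}
    (hf : IntervalIntegrable (integrand₂ α m ω f) volume 0 b)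
    (hp : IntervalIntegrable (integrand₂ α m ω p) volume 0 b)
    (hg : ∀ x ∈ Icc 0 b, f x - p x = g x) : I₂ α b m ω f - I₂ α b m ω p = I₂ α b m ω g := by
  rw [I₂, I₂, ← intervalIntegral.integral_sub hf hp]
  refine intervalIntegral.integral_congr fun x hx => ?_
  rw [uIcc_of_le hb] at hx
  simp only [integrand₂, ← hg x hx]
  ring

end HCCF

/-! ### Convergence and error bounds for the quadrature rules -/

theorem theorem4p1 (α b : ℝ) (m : ℂ) (N s : ℕ) (f : ℝ → ℂ)
    (hα : -1 < α) (hm : -1 < m.re) (hαm : -1 < α + m.re) (hb : 0 < b) (hN : 1 ≤ N)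
    (hf : ContDiffOn ℝ ((s + 2 : ℕ) : WithTop ℕ∞) f (Set.Icc 0 b)) :
    (∀ ω : ℝ, 1 ≤ ω →
      IntervalIntegrable (HCCF.integrand₁ α m ω f) MeasureTheory.volume 0 b ∧
      IntervalIntegrable (HCCF.integrand₂ α m ω f) MeasureTheory.volume 0 b ∧
      IntervalIntegrable (HCCF.integrand₁ α m ω (HCCF.hermiteFun b N s f))
        MeasureTheory.volume 0 b ∧
      IntervalIntegrable (HCCF.integrand₂ α m ω (HCCF.hermiteFun b N s f))
        MeasureTheory.volume 0 b) ∧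
    (∃ K : ℝ, ∀ ω : ℝ, 1 ≤ ω →
      ‖HCCF.I₁ α b m ω f - HCCF.I₁HCCF α b m N s ω f‖ ≤
        K * (HCCF.C₁ α ω / ω ^ (s + 1))) ∧
    (∃ K : ℝ, ∀ ω : ℝ, 1 ≤ ω →
      ‖HCCF.I₂ α b m ω f - HCCF.I₂HCCF α b m N s ω f‖ ≤
        K * (HCCF.C₂ α ω / ω ^ (s + 1))) := by
  have hfc := hf.continuousOn
  have hpc : ContinuousOn (HCCF.hermiteFun b N s f) (Set.Icc 0 b) :=
    (HCCF.contDiff_eval_ofReal (HCCF.hermiteInterpolant b N s f) 0).continuous.continuousOn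
  have h₁ : ∀ ω : ℝ, 1 ≤ ω → ∀ h, ContinuousOn h (Set.Icc 0 b) →
      IntervalIntegrable (HCCF.integrand₁ α m ω h) MeasureTheory.volume 0 b := fun ω hω h hh =>
    HCCF.intervalIntegrable_integrand₁ hm hαm hb.le hh (zero_lt_one.trans_le hω)
  have h₂ : ∀ ω : ℝ, 1 ≤ ω → ∀ h, ContinuousOn h (Set.Icc 0 b) →
      IntervalIntegrable (HCCF.integrand₂ α m ω h) MeasureTheory.volume 0 b := fun ω hω h hh =>
    HCCF.intervalIntegrable_integrand₂ hm hαm hb.le hh (zero_lt_one.trans_le hω)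
  obtain ⟨g, hg, hge⟩ := HCCF.exists_vanishesAtEnds_eqOn_sub hb hN hf
  refine ⟨fun ω hω => ⟨h₁ ω hω _ hfc, h₂ ω hω _ hfc, h₁ ω hω _ hpc, h₂ ω hω _ hpc⟩, ?_, ?_⟩
  · obtain ⟨K, hK⟩ := HCCF.exists_norm_I₁_le_div_pow hm hαm hb hg
    refine ⟨K, fun ω hω => ?_⟩
    rw [HCCF.I₁HCCF, HCCF.I₁_sub hb.le (h₁ ω hω _ hfc) (h₁ ω hω _ hpc) hge]
    exact hK ω hω
  · obtain ⟨K, hK⟩ := HCCF.exists_norm_I₂_le_div_pow hm hαm hb hg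
    refine ⟨K, fun ω hω => ?_⟩
    rw [HCCF.I₂HCCF, HCCF.I₂_sub hb.le (h₂ ω hω _ hfc) (h₂ ω hω _ hpc) hge]
    exact hK ω hω
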